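/- **Setting.** Let $\mathcal X$ be the target space with its $\sigma$-algebra of Borel sets. A point process on $\mathcal X$ is described by its law $P_\Phi$ on the space of finite configurations $\varphi=\{x_1,\dots,x_n\}$ (points counted with multiplicity). Write $N(B)=\sum_{x\in\varphi}1_B(x)$, $\mu_\Phi(B)=\mathbb E[N_\Phi(B)]$ for the first moment measure and $\mathrm{var}_\Phi(B)=\mathbb E[N_\Phi(B)^2]-\mathbb E[N_\Phi(B)]^2$ for the regional variance in target number. Assume: 1. The predicted process $\Phi$ is i.i.d. with cardinality distribution $\rho_\Phi$ and finite first moment measure $\mu_\Phi$: it has $n$ points with probability $\rho_\Phi(n)$ and, given $n$, its points are independent with a common distribution. 2. A target $x$ is detected with probability $p_d(x)$; if detected, it produces a single measurement $z$ with likelihood $\hat L(z|x)$. Put $P(z|x)=p_d(x)\hat L(z|x)$ and $P(\phi|x)=1-p_d(x)$. 3. The clutter is an i.i.d. process with cardinality distribution $\rho_c$ and spatial density $c$. The detections of the different targets and the clutter are independent. Accordingly the likelihood of a finite set $Z$ of measurements, given targets $x_1,\dots,x_n$, is $$L(Z|x_{1:n})=\sum_{W_0\sqcup W_1\sqcup\dots\sqcup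 W_n=Z}|W_0|!\,\rho_c(|W_0|)\prod_{z\in W_0}c(z)\ \prod_{j=1}^n f(W_j|x_j),$$ where the sum is over all ways to write $Z$ as an ordered disjoint union of possibly empty sets, $f(\emptyset|x)=P(\phi|x)$, $f(\{z\}|x)=P(z|x)$ and $f(W|x)=0$ if $|W|\ge2$. Let $Z=\{z_1,\dots,z_m\}$ be the observed set of (distinct) measurements, and suppose that $c(z)>0$ and $\int P(z|x)\,\mu_\Phi(dx)<\infty$ for every $z\in Z$, and that $\int L(Z|\varphi)P_\Phi(d\varphi)\neq0$. The updated process $\Phi_+$ is given by Bayes' rule, $$P_{\Phi_+}(d\xi)=\frac{L(Z|\xi)\,P_\Phi(d\xi)}{\int L(Z|\varphi)\,P_\Phi(d\varphi)} .$$ **Notation.** For measurable $B$ let $\mu^z_\Phi(B)=\int_B P(z|x)\,\mu_\Phi(dx)$ and $\mu^\phi_\Phi(B)=\int_B P(\phi|x)\,\mu_\Phi(dx)$. For $u\in\{0,1,2\}$, $V\subseteq Z$ and $n\ge0$ let $$\Upsilon^u[V](n)=\sum_{d=0}^{\min(|V|,n)}\frac{n!\,(|V|-d)!}{(n-(d+u))!}\,\rho_c(|V|-d)\,\frac{\mu^\phi_\Phi(\mathcal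 X)^{n-(d+u)}}{\mu_\Phi(\mathcal X)^n}\,e_d(V),\qquad e_d(V)=\sum_{S\subseteq V,\ |S|=d}\ \prod_{z\in S}\frac{\mu^z_\Phi(\mathcal X)}{c(z)},$$ where terms with $d+u>n$ are zero, let $\langle\Upsilon^u[V],\rho_\Phi\rangle=\sum_{n\ge0}\Upsilon^u[V](n)\rho_\Phi(n)$, and put, for $u=1,2$, $$\ell_u(\phi)=\frac{\langle\Upsilon^u[Z],\rho_\Phi\rangle}{\langle\Upsilon^0[Z],\rho_\Phi\rangle},\quad \ell_u(z)=\frac{\langle\Upsilon^u[Z\setminus\{z\}],\rho_\Phi\rangle}{\langle\Upsilon^0[Z],\rho_\Phi\rangle},\quad \ell_2^{\neq}(z,z')=\begin{cases}\dfrac{\langle\Upsilon^2[Z\setminus\{z,z'\}],\rho_\Phi\rangle}{\langle\Upsilon^0[Z],\rho_\Phi\rangle}& z\ne z',\\[2mm] 0& z=z'.\end{cases}$$ **Theorem (regional statistics, CPHD update).** The law of $\Phi_+$ is a well-defined probability measure, the series $\langle\Upsilon^u[V],\rho_\Phi\rangle$ with $u\in\{0,1\}$ and $V\subseteq Z$ converge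 and, for every measurable $B\subseteq\mathcal X$, $N_{\Phi_+}(B)$ is integrable with $$\mu_{\Phi_+}(B)=\mu^\phi_\Phi(B)\,\ell_1(\phi)+\sum_{z\in Z}\frac{\mu^z_\Phi(B)}{c(z)}\,\ell_1(z).$$ If moreover $\mathbb E[N_{\Phi_+}(\mathcal X)^2]<\infty$ (which holds in particular if $\mathbb E[N_{\Phi}(\mathcal X)^2]<\infty$), then the series $\langle\Upsilon^2[V],\rho_\Phi\rangle$, $V\subseteq Z$, also converge and, for every measurable $B\subseteq\mathcal X$, $\mathbb E[N_{\Phi_+}(B)^2]<\infty$ and $$\begin{aligned}\mathrm{var}_{\Phi_+}(B)=\mu_{\Phi_+}(B)&+\mu^\phi_\Phi(B)^2\left[\ell_2(\phi)-\ell_1(\phi)^2\right]+2\mu^\phi_\Phi(B)\sum_{z\in Z}\frac{\mu^z_\Phi(B)}{c(z)}\left[\ell_2(z)-\ell_1(z)\ell_1(\phi)\right]\\&+\sum_{z,z'\in Z}\frac{\mu^z_\Phi(B)}{c(z)}\frac{\mu^{z'}_\Phi(B)}{c(z')}\left[\ell_2^{\neq}(z,z')-\ell_1(z)\ell_1(z')\right].\end{aligned}$$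 -/

import Mathlib

open MeasureTheory
open scoped ENNReal Nat

namespace CPHD

noncomputable section

/-! ### Point processes -/

/-- Finite point configurations `{x₁, …, xₙ}` in `X`. Coinciding points are counted with their
multiplicity, so that laws with atoms are covered as well. -/
abbrev Config (X : Type*) := Multiset X

/-- The configuration `{x₁, …, xₙ}` enumerated by a tuple. -/
def ofTuple {X : Type*} {n : ℕ} (x : Fin n → X) : Config X := Finset.univ.val.map x

/-- The `σ`-algebra of the disjoint union of the quotients `Xⁿ / 𝔖ₙ`: a set of configurations is
measurable iff, for every `n`, the set of its enumerations is measurable in `Xⁿ`. -/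
instance {X : Type*} [MeasurableSpace X] : MeasurableSpace (Config X) :=
  ⨅ n : ℕ, MeasurableSpace.map (fun x : Fin n → X => ofTuple x) inferInstance

/-- `N(B) = ∑_{x ∈ ξ} 1_B(x)`, the number of points of the configuration `ξ` in `B`. -/
def count {X : Type*} (B : Set X) (ξ : Config X) : ℝ :=
  (ξ.map (B.indicator fun _ => (1 : ℝ))).sum

/-- `μ` is the first moment measure of the point process with law `P`: `μ(B) = 𝔼[N(B)]`. -/
def IsFirstMomentMeasure {X : Type*} [MeasurableSpace X] (P : Measure (Config X))
    (μ : Measure X) : Prop :=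
  ∀ B, MeasurableSet B → μ B = ∫⁻ ξ, ENNReal.ofReal (count B ξ) ∂P

/-- The mean target number `𝔼[N(B)]` in the region `B`. -/
def mean {X : Type*} [MeasurableSpace X] (P : Measure (Config X)) (B : Set X) : ℝ :=
  ∫ ξ, count B ξ ∂P

/-- The second moment `𝔼[N(B) N(B')]`. -/
def secondMoment {X : Type*} [MeasurableSpace X] (P : Measure (Config X)) (B B' : Set X) : ℝ :=
  ∫ ξ, count B ξ * count B' ξ ∂P

/-- The regional variance in target number. -/
def var {X : Type*} [MeasurableSpace X] (P : Measure (Config X)) (B : Set X) : ℝ :=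
  secondMoment P B B - mean P B ^ 2

/-- The law of the process whose number of points has distribution `ρ` and whose points are,
given their number, independent with common distribution `s`. -/
def iidLaw {X : Type*} [MeasurableSpace X] (ρ : PMF ℕ) (s : Measure X) : Measure (Config X) :=
  Measure.sum fun n : ℕ =>
    ρ n • (Measure.pi fun _ : Fin n => s).map (fun x : Fin n → X => ofTuple x)

/-- `P` is the law of an i.i.d. process with cardinality distribution `ρ`. -/
def IsIIDProcess {X : Type*} [MeasurableSpace X] (P : Measure (Config X)) (ρ : PMF ℕ) : Prop :=
  ∃ s : Measure X, IsProbabilityMeasure s ∧ P = iidLaw ρ s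

/-! ### The observation model -/

/-- The observation model: probability of detection `pd x`, likelihood `lik z x` of the
measurement `z` given a detected target in state `x`, and an i.i.d. clutter process with
cardinality distribution `ρc` and spatial density `c`. The normalisation of the densities
`lik · x` and `c` with respect to a reference measure on the measurement space is not imposed. -/
structure Sensor (X Z : Type*) [MeasurableSpace X] where
  pd : X → ℝ
  measurable_pd : Measurable pd
  pd_nonneg : ∀ x, 0 ≤ pd x
  pd_le_one : ∀ x, pd x ≤ 1
  lik : Z → X → ℝ
  measurable_lik : ∀ z, Measurable (lik z)
  lik_nonneg : ∀ z x, 0 ≤ lik z x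
  ρc : PMF ℕ
  c : Z → ℝ
  c_nonneg : ∀ z, 0 ≤ c z

/-- Multi-object density of the superposition of two independent processes with multi-object
densities `f` and `g`: the sum over all ways of sharing out the points of `W`. -/
def superpose {Z : Type*} [DecidableEq Z] (f g : Finset Z → ℝ) (W : Finset Z) : ℝ :=
  ∑ S ∈ W.powerset, f S * g (W \ S)

theorem superpose_left_comm {Z : Type*} [DecidableEq Z] (f g h : Finset Z → ℝ) :
    superpose f (superpose g h) = superpose g (superpose f h) := by
  funext W
  simp only [superpose, Finset.mul_sum]
  rw [Finset.sum_sigma', Finset.sum_sigma']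
  refine Finset.sum_bij' (fun p _ => ⟨p.2, p.1⟩) (fun p _ => ⟨p.2, p.1⟩) ?_ ?_ ?_ ?_ ?_
  · rintro ⟨S, T⟩ h
    simp only [Finset.mem_sigma, Finset.mem_powerset, Finset.subset_sdiff] at h ⊢
    exact ⟨h.2.1, h.1, h.2.2.symm⟩
  · rintro ⟨S, T⟩ h
    simp only [Finset.mem_sigma, Finset.mem_powerset, Finset.subset_sdiff] at h ⊢
    exact ⟨h.2.1, h.1, h.2.2.symm⟩
  · rintro ⟨S, T⟩ _
    rfl
  · rintro ⟨S, T⟩ _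
    rfl
  · rintro ⟨S, T⟩ _
    dsimp only
    rw [sdiff_right_comm]
    ring

namespace Sensor

variable {X Z : Type*} [MeasurableSpace X]

/-- `P(φ|x) = 1 - p_d(x)`. -/
def missKernel (M : Sensor X Z) (x : X) : ℝ := 1 - M.pd x

/-- `P(z|x) = p_d(x) L̂(z|x)`. -/
def detKernel (M : Sensor X Z) (z : Z) (x : X) : ℝ := M.pd x * M.lik z x

/-- Multi-object density of the measurements produced by a single target `x`: none with
weight `P(φ|x)`, or a single one `z` with density `P(z|x)`. -/
def targetDensity (M : Sensor X Z) (x : X) (W : Finset Z) : ℝ :=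
  if W.card = 0 then M.missKernel x else if W.card = 1 then ∑ z ∈ W, M.detKernel z x else 0

/-- Multi-object density `m! ρ_c(m) c(z₁) ⋯ c(z_m)` of the clutter process. -/
def clutterDensity (M : Sensor X Z) (W : Finset Z) : ℝ :=
  (W.card)! * (M.ρc W.card).toReal * ∏ z ∈ W, M.c z

instance [DecidableEq Z] (M : Sensor X Z) :
    LeftCommutative (fun (x : X) (g : Finset Z → ℝ) => superpose (M.targetDensity x) g) :=
  ⟨fun _ _ _ => superpose_left_comm _ _ _⟩

/-- The multi-measurement/multi-target likelihood `L(W|ξ)`: the measurement set is the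
superposition of the clutter and of the measurements of all targets, all independent. -/
def likelihood [DecidableEq Z] (M : Sensor X Z) (W : Finset Z) (ξ : Config X) : ℝ :=
  ξ.foldr (fun x g => superpose (M.targetDensity x) g) M.clutterDensity W

/-- The normalising constant `∫ L(W|ξ) P(dξ)` of Bayes' rule. -/
def evidence [DecidableEq Z] (M : Sensor X Z) (P : Measure (Config X)) (W : Finset Z) : ℝ≥0∞ :=
  ∫⁻ ξ, ENNReal.ofReal (M.likelihood W ξ) ∂P

/-- Bayes' rule: the law `L(W|ξ) P(dξ) / ∫ L(W|ξ') P(dξ')` of the updated process. -/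
def update [DecidableEq Z] (M : Sensor X Z) (P : Measure (Config X)) (W : Finset Z) :
    Measure (Config X) :=
  (M.evidence P W)⁻¹ • P.withDensity fun ξ => ENNReal.ofReal (M.likelihood W ξ)

/-! ### Regional terms, `Υ` functions and corrector terms -/

/-- `μ^φ(B) = ∫ 1_B(x) P(φ|x) μ(dx)`. -/
def missMass (M : Sensor X Z) (μ : Measure X) (B : Set X) : ℝ := ∫ x in B, M.missKernel x ∂μ

/-- `μ^z(B) = ∫ 1_B(x) P(z|x) μ(dx)`. -/
def detMass (M : Sensor X Z) (μ : Measure X) (z : Z) (B : Set X) : ℝ :=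
  ∫ x in B, M.detKernel z x ∂μ

/-- The elementary symmetric function `e_d` of the family `μ^z(X) / c(z)`, `z ∈ W`. -/
def esymm (M : Sensor X Z) (μ : Measure X) (d : ℕ) (W : Finset Z) : ℝ :=
  ∑ S ∈ W.powersetCard d, ∏ z ∈ S, M.detMass μ z Set.univ / M.c z

/-- Vo's function `Υ^u[μ, W](n)`. The quotient `n! / (n - (d + u))!` is the number
`n.descFactorial (d + u)` of arrangements, which is zero when `d + u > n`. -/
def upsilon (M : Sensor X Z) (μ : Measure X) (u : ℕ) (W : Finset Z) (n : ℕ) : ℝ :=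
  ∑ d ∈ Finset.range (min W.card n + 1),
    (n.descFactorial (d + u) : ℝ) * (W.card - d)! * (M.ρc (W.card - d)).toReal *
      (M.missMass μ Set.univ ^ (n - (d + u)) / μ.real Set.univ ^ n) * M.esymm μ d W

/-- `⟨Υ^u[μ, W], ρ⟩ = ∑ₙ Υ^u[μ, W](n) ρ(n)`. -/
def pairing (M : Sensor X Z) (μ : Measure X) (ρ : PMF ℕ) (u : ℕ) (W : Finset Z) : ℝ :=
  ∑' n : ℕ, M.upsilon μ u W n * (ρ n).toReal

/-- `⟨Υ^u[μ, V], ρ⟩ / ⟨Υ^0[μ, W], ρ⟩`, where `W` is the measurement set. The corrector terms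
`ℓ_u(φ)`, `ℓ_u(z)`, `ℓ_u(z, z')` have `V = W`, `V = W \ {z}`, `V = W \ {z, z'}`. -/
def corrector (M : Sensor X Z) (μ : Measure X) (ρ : PMF ℕ) (W : Finset Z) (u : ℕ)
    (V : Finset Z) : ℝ :=
  M.pairing μ ρ u V / M.pairing μ ρ 0 W

/-- `ℓ₁(φ)`. -/
def ell1Miss (M : Sensor X Z) (μ : Measure X) (ρ : PMF ℕ) (W : Finset Z) : ℝ :=
  M.corrector μ ρ W 1 W

/-- `ℓ₁(z)`. -/
def ell1 [DecidableEq Z] (M : Sensor X Z) (μ : Measure X) (ρ : PMF ℕ) (W : Finset Z) (z : Z) :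
    ℝ :=
  M.corrector μ ρ W 1 (W \ {z})

/-- `ℓ₂(φ)`. -/
def ell2Miss (M : Sensor X Z) (μ : Measure X) (ρ : PMF ℕ) (W : Finset Z) : ℝ :=
  M.corrector μ ρ W 2 W

/-- `ℓ₂(z)`. -/
def ell2 [DecidableEq Z] (M : Sensor X Z) (μ : Measure X) (ρ : PMF ℕ) (W : Finset Z) (z : Z) :
    ℝ :=
  M.corrector μ ρ W 2 (W \ {z})

/-- `ℓ₂^≠(z, z')`: the term `ℓ₂(z, z')` if `z ≠ z'`, and zero otherwise. -/
def ell2Pair [DecidableEq Z] (M : Sensor X Z) (μ : Measure X) (ρ : PMF ℕ) (W : Finset Z)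
    (z z' : Z) : ℝ :=
  if z ≠ z' then M.corrector μ ρ W 2 (W \ {z, z'}) else 0

end Sensor

end

end CPHD

/-! Given `n` targets, the likelihood is an iterated superposition, and superposition is bilinear
and commuting (`superpose_left_comm`). Integrating over independent points therefore superposes the
averaged single-target densities `regionDensity` with the clutter. Weighting by `count B` confines
one target to `B`, with `n` choices for it; weighting by the falling factorial `count B * (count B -
1)` confines two, with `n * (n - 1)` choices. The remaining `n - u` targets contribute
`predictedDensity`.

A target yields at most one measurement, so this density is a sum over partial matchings of targets
with measurements (`iterate_superpose_eq`). The identity `descFactorial_mul_predictedDensity` turns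
it into `upsilon`, up to the factor `∏ c`. Summing against `ρ` and dividing by the evidence cancels
`∏ c` and produces the correctors. The variance is the second factorial moment plus the mean minus
the squared mean.

Two points remain. The computation uses the law `s` of one point, whereas the theorem uses `μ = r •
s`; the powers of `r` cancel by homogeneity. Convergence is geometric if the missed mass of `s` is
below one; otherwise almost no target is detectable and the series reduce to factorial moments of
`ρ`. -/

namespace CPHD

/-! ### Superposition of at most simple processes as a sum over matchings. -/

section Superpose

variable {Z : Type*}

/-- The sum over the partial matchings of `k` targets with the elements of `V`: matched elements
have weight `w`, unmatched targets weight `a`, and `j` unmatched elements weight `r j`. -/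
noncomputable def matchingSum (r : ℕ → ℝ) (w : Z → ℝ) (a : ℝ) (k : ℕ) (V : Finset Z) : ℝ :=
  ∑ d ∈ Finset.range (V.card + 1), (k.descFactorial d : ℝ) * r (V.card - d) * a ^ (k - d) *
    ∑ S ∈ V.powersetCard d, ∏ z ∈ S, w z

theorem matchingSum_zero (r : ℕ → ℝ) (w : Z → ℝ) (a : ℝ) (V : Finset Z) :
    matchingSum r w a 0 V = r V.card := by
  rw [matchingSum, Finset.sum_range_succ', Finset.sum_eq_zero]
  · simp
  · intro d _
    simp

variable [DecidableEq Z]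

theorem superpose_smul (f : Finset Z → ℝ) (r : ℝ) (g : Finset Z → ℝ) :
    superpose f (r • g) = r • superpose f g := by
  funext V
  simp only [superpose, Pi.smul_apply, smul_eq_mul, Finset.mul_sum]
  exact Finset.sum_congr rfl fun S _ => by ring

/-- Superposition with a process having at most one point. -/
theorem superpose_eq_of_card_le_one {f : Finset Z → ℝ} (hf : ∀ S, 2 ≤ S.card → f S = 0)
    (g : Finset Z → ℝ) (V : Finset Z) :
    superpose f g V = f ∅ * g V + ∑ z ∈ V, f {z} * g (V \ {z}) := by
  have hsub : insert ∅ (V.image fun z => ({z} : Finset Z)) ⊆ V.powerset := by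
    intro S hS
    simp only [Finset.mem_insert, Finset.mem_image, Finset.mem_powerset] at hS ⊢
    rcases hS with rfl | ⟨z, hz, rfl⟩
    · exact Finset.empty_subset _
    · simpa using hz
  rw [superpose, ← Finset.sum_subset hsub, Finset.sum_insert, Finset.sum_image]
  · simp
  · intro x _ y _ h
    simpa using h
  · simp
  · intro S hS hS'
    rw [hf S, zero_mul]
    by_contra hlt
    apply hS'
    simp only [Finset.mem_insert, Finset.mem_image]
    rcases Nat.lt_or_ge S.card 1 with h | h
    · left
      exact Finset.card_eq_zero.1 (by omega)
    · right
      obtain ⟨z, rfl⟩ := Finset.card_eq_one.1 (show S.card = 1 by omega)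
      exact ⟨z, by simpa using hS, rfl⟩

/-- Double counting of the pairs `(T, z)` with `z ∈ T ⊆ V` and `T` of size `d + 1`. -/
theorem sum_mul_powersetCard_sdiff (w : Z → ℝ) (d : ℕ) (V : Finset Z) :
    ∑ z ∈ V, w z * ∑ S ∈ (V \ {z}).powersetCard d, ∏ y ∈ S, w y =
      (d + 1) * ∑ S ∈ V.powersetCard (d + 1), ∏ y ∈ S, w y := by
  have h : ∀ S ∈ V.powersetCard (d + 1), ((d : ℝ) + 1) * ∏ y ∈ S, w y =
      ∑ z ∈ S, w z * ∏ y ∈ S \ {z}, w y := by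
    intro S hS
    rw [Finset.sum_congr rfl fun z hz =>
      (by rw [Finset.sdiff_singleton_eq_erase, Finset.mul_prod_erase S w hz] :
        w z * ∏ y ∈ S \ {z}, w y = ∏ y ∈ S, w y), Finset.sum_const,
      (Finset.mem_powersetCard.1 hS).2]
    simp
  rw [Finset.mul_sum, Finset.sum_congr rfl h]
  simp only [Finset.mul_sum]
  rw [Finset.sum_sigma', Finset.sum_sigma']
  refine Finset.sum_bij' (fun p _ => ⟨insert p.1 p.2, p.1⟩) (fun p _ => ⟨p.2, p.1 \ {p.2}⟩)
    ?_ ?_ ?_ ?_ ?_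
  · rintro ⟨z, S⟩ h
    simp only [Finset.mem_sigma, Finset.mem_powersetCard, Finset.subset_sdiff,
      Finset.disjoint_singleton_right] at h ⊢
    refine ⟨⟨Finset.insert_subset h.1 h.2.1.1, ?_⟩, Finset.mem_insert_self _ _⟩
    rw [Finset.card_insert_of_notMem h.2.1.2, h.2.2]
  · rintro ⟨S, z⟩ h
    simp only [Finset.mem_sigma, Finset.mem_powersetCard] at h ⊢
    refine ⟨h.1.1 h.2, Finset.sdiff_subset_sdiff h.1.1 subset_rfl, ?_⟩
    rw [Finset.sdiff_singleton_eq_erase, Finset.card_erase_of_mem h.2, h.1.2]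
    rfl
  · rintro ⟨z, S⟩ h
    simp only [Finset.mem_sigma, Finset.mem_powersetCard, Finset.subset_sdiff,
      Finset.disjoint_singleton_right] at h
    simp [Finset.sdiff_singleton_eq_erase, Finset.erase_insert h.2.1.2]
  · rintro ⟨S, z⟩ h
    simp only [Finset.mem_sigma] at h
    simp [Finset.sdiff_singleton_eq_erase, Finset.insert_erase h.2]
  · rintro ⟨z, S⟩ h
    simp only [Finset.mem_sigma, Finset.mem_powersetCard, Finset.subset_sdiff,
      Finset.disjoint_singleton_right] at h
    simp [Finset.sdiff_singleton_eq_erase, Finset.erase_insert h.2.1.2]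

/-- Injections of `d + 1` measurements into `k + 1` targets either avoid the last target or send one
of the `d + 1` measurements to it; powers of `a` count the unmatched targets. If `d ≥ k`, the
truncated exponent `k - (d + 1)` is harmless because its coefficient is zero. -/
theorem descFactorial_succ_mul_pow (a : ℝ) (k d : ℕ) :
    ((k + 1).descFactorial (d + 1) : ℝ) * a ^ (k - d) =
      a * ((k.descFactorial (d + 1) : ℝ) * a ^ (k - (d + 1))) +
        (d + 1) * ((k.descFactorial d : ℝ) * a ^ (k - d)) := by
  have h : (k + 1).descFactorial (d + 1) =
      k.descFactorial (d + 1) + (d + 1) * k.descFactorial d := by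
    rcases le_or_gt d k with hdk | hdk
    · rw [Nat.succ_descFactorial_succ, Nat.descFactorial_succ, ← add_mul]
      congr 1
      omega
    · rw [Nat.descFactorial_of_lt (by omega), Nat.descFactorial_of_lt (by omega),
        Nat.descFactorial_of_lt hdk]
      simp
  rw [h]
  rcases Nat.lt_or_ge d k with hdk | hdk
  · obtain ⟨j, rfl⟩ : ∃ j, k = d + 1 + j := ⟨k - (d + 1), by omega⟩
    rw [show d + 1 + j - d = j + 1 by omega, show d + 1 + j - (d + 1) = j by omega]
    push_cast
    ring
  · rw [Nat.descFactorial_of_lt (show k < d + 1 by omega)]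
    simp [Nat.sub_eq_zero_of_le hdk, Nat.sub_eq_zero_of_le (hdk.trans (Nat.le_succ d))]

/-- The additional target is either unmatched, with weight `a`, or matched with some `z`, which is
then removed from `V`. This is the recursion that superposition with an at most simple process
satisfies. -/
theorem matchingSum_succ (r : ℕ → ℝ) (w : Z → ℝ) (a : ℝ) (k : ℕ) (V : Finset Z) :
    matchingSum r w a (k + 1) V =
      a * matchingSum r w a k V + ∑ z ∈ V, w z * matchingSum r w a k (V \ {z}) := by
  have hcard : ∀ z ∈ V, (V \ {z}).card = V.card - 1 := fun z hz => by
    rw [Finset.sdiff_singleton_eq_erase, Finset.card_erase_of_mem hz]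
  have hsum : ∑ z ∈ V, w z * matchingSum r w a k (V \ {z}) =
      ∑ d ∈ Finset.range V.card, (k.descFactorial d : ℝ) * r (V.card - (d + 1)) * a ^ (k - d) *
        ((d + 1) * ∑ S ∈ V.powersetCard (d + 1), ∏ y ∈ S, w y) := by
    simp only [← sum_mul_powersetCard_sdiff, Finset.mul_sum (s := V)]
    rw [Finset.sum_comm]
    refine Finset.sum_congr rfl fun z hz => ?_
    have hpos : 0 < V.card := Finset.card_pos.2 ⟨z, hz⟩
    rw [matchingSum, hcard z hz, Nat.sub_add_cancel hpos, Finset.mul_sum]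
    refine Finset.sum_congr rfl fun d _ => ?_
    rw [show V.card - 1 - d = V.card - (d + 1) by omega]
    ring
  rw [hsum, matchingSum, matchingSum, Finset.sum_range_succ', Finset.sum_range_succ' _ V.card,
    mul_add, Finset.mul_sum (Finset.range V.card), add_right_comm, ← Finset.sum_add_distrib]
  congr 1
  · refine Finset.sum_congr rfl fun d _ => ?_
    have h := descFactorial_succ_mul_pow a k d
    rw [Nat.add_sub_add_right]
    linear_combination (r (V.card - (d + 1)) * ∑ S ∈ V.powersetCard (d + 1), ∏ y ∈ S, w y) * h
  · simp [pow_succ]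
    ring

/-- The density of the superposition of `k` at most simple processes with a process of density
`j! r j ∏ c`. -/
theorem iterate_superpose_eq {f κ : Finset Z → ℝ} (hf : ∀ S, 2 ≤ S.card → f S = 0)
    {r : ℕ → ℝ} {c : Z → ℝ} (hκ : ∀ V, κ V = r V.card * ∏ z ∈ V, c z) {W : Finset Z}
    (hc : ∀ z ∈ W, 0 < c z) (k : ℕ) : ∀ V ⊆ W, (superpose f)^[k] κ V =
      (∏ z ∈ V, c z) * matchingSum r (fun z => f {z} / c z) (f ∅) k V := by
  induction k with
  | zero =>
    intro V _
    rw [matchingSum_zero, Function.iterate_zero, id, hκ, mul_comm]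
  | succ k ih =>
    intro V hV
    rw [Function.iterate_succ_apply', superpose_eq_of_card_le_one hf, matchingSum_succ, ih V hV,
      mul_add, Finset.mul_sum]
    congr 1
    · ring
    · refine Finset.sum_congr rfl fun z hz => ?_
      rw [ih _ (Finset.sdiff_subset.trans hV), Finset.sdiff_singleton_eq_erase,
        ← Finset.mul_prod_erase V c hz]
      have := (hc z (hV hz)).ne'
      field_simp

end Superpose

/-! ### Configurations through their enumerations. -/

section Tuples

variable {X : Type*}

theorem ofTuple_succ {n : ℕ} (x : Fin (n + 1) → X) :
    ofTuple x = x 0 ::ₘ ofTuple fun i => x i.succ := by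
  simp only [ofTuple, Fin.univ_val_map, List.ofFn_succ]
  rfl

theorem count_cons (B : Set X) (x : X) (ξ : Config X) :
    count B (x ::ₘ ξ) = B.indicator (fun _ => (1 : ℝ)) x + count B ξ := by
  simp [count]

theorem count_ofTuple (B : Set X) {n : ℕ} (x : Fin n → X) :
    count B (ofTuple x) = ∑ i, B.indicator (fun _ => (1 : ℝ)) (x i) := by
  simp [count, ofTuple, Finset.sum, Function.comp_def]

theorem count_nonneg (B : Set X) (ξ : Config X) : 0 ≤ count B ξ := by
  induction ξ using Multiset.induction with
  | empty => simp [count]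
  | cons x ξ ih =>
    rw [count_cons]
    exact add_nonneg (Set.indicator_nonneg (fun _ _ => zero_le_one) _) ih

variable [MeasurableSpace X]

theorem measurable_ofTuple (n : ℕ) : Measurable fun x : Fin n → X => ofTuple x := by
  rw [measurable_iff_le_map]
  exact iInf_le _ n

theorem measurable_config {E : Type*} [MeasurableSpace E] {g : Config X → E}
    (hg : ∀ n, Measurable fun x : Fin n → X => g (ofTuple x)) : Measurable g := by
  intro A hA
  rw [MeasurableSpace.measurableSet_iInf]
  exact fun n => hg n hA

theorem measurable_count {B : Set X} (hB : MeasurableSet B) :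
    Measurable (count B : Config X → ℝ) := by
  refine measurable_config fun n => ?_
  simp only [count_ofTuple]
  exact Finset.measurable_sum _ fun i _ =>
    (measurable_const.indicator hB).comp (measurable_pi_apply i)

theorem integrable_integral_pi_succ {s : Measure X} [IsProbabilityMeasure s] {n : ℕ}
    {f : X → ℝ} {g : (Fin n → X) → ℝ} (hf : Integrable f s)
    (hg : Integrable g (Measure.pi fun _ => s)) :
    Integrable (fun x : Fin (n + 1) → X => f (x 0) * g fun i => x i.succ) (Measure.pi fun _ => s) ∧
      ∫ x : Fin (n + 1) → X, f (x 0) * (g fun i => x i.succ) ∂(Measure.pi fun _ => s) =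
        (∫ x, f x ∂s) * ∫ x, g x ∂(Measure.pi fun _ => s) := by
  have he := measurePreserving_piFinSuccAbove (fun _ : Fin (n + 1) => s) 0
  have h := hf.mul_prod hg
  constructor
  · exact (he.integrable_comp_emb (MeasurableEquiv.measurableEmbedding _)).2 h
  · rw [← integral_prod_mul]
    exact he.integral_comp (MeasurableEquiv.measurableEmbedding _) fun p => f p.1 * g p.2

end Tuples

namespace Sensor

variable {X Z : Type*} [MeasurableSpace X]

/-! ### Positivity, measurability and integrability of the densities. -/

section Densities

variable (M : Sensor X Z)

theorem missKernel_nonneg (x : X) : 0 ≤ M.missKernel x := sub_nonneg.2 (M.pd_le_one x)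

theorem missKernel_le_one (x : X) : M.missKernel x ≤ 1 := sub_le_self _ (M.pd_nonneg x)

theorem measurable_missKernel : Measurable M.missKernel := measurable_const.sub M.measurable_pd

theorem detKernel_nonneg (z : Z) (x : X) : 0 ≤ M.detKernel z x :=
  mul_nonneg (M.pd_nonneg x) (M.lik_nonneg z x)

theorem measurable_detKernel (z : Z) : Measurable (M.detKernel z) :=
  M.measurable_pd.mul (M.measurable_lik z)

theorem integrable_missKernel (s : Measure X) [IsFiniteMeasure s] : Integrable M.missKernel s :=
  Integrable.of_bound M.measurable_missKernel.aestronglyMeasurable 1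
    (Filter.Eventually.of_forall fun x => by
      rw [Real.norm_of_nonneg (M.missKernel_nonneg x)]
      exact M.missKernel_le_one x)

theorem targetDensity_empty (x : X) : M.targetDensity x ∅ = M.missKernel x := by
  simp [targetDensity]

theorem targetDensity_singleton (x : X) (z : Z) : M.targetDensity x {z} = M.detKernel z x := by
  simp [targetDensity]

theorem targetDensity_eq_zero (x : X) {S : Finset Z} (hS : 2 ≤ S.card) :
    M.targetDensity x S = 0 := by
  rw [targetDensity, if_neg (by omega), if_neg (by omega)]

theorem targetDensity_nonneg (x : X) (S : Finset Z) : 0 ≤ M.targetDensity x S := by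
  rw [targetDensity]
  split_ifs
  · exact M.missKernel_nonneg x
  · exact Finset.sum_nonneg fun z _ => M.detKernel_nonneg z x
  · exact le_rfl

theorem measurable_targetDensity (S : Finset Z) : Measurable fun x => M.targetDensity x S := by
  unfold targetDensity
  split_ifs
  · exact M.measurable_missKernel
  · exact Finset.measurable_sum _ fun z _ => M.measurable_detKernel z
  · exact measurable_const

theorem integrable_targetDensity {s : Measure X} [IsFiniteMeasure s] {W : Finset Z}
    (hdet : ∀ z ∈ W, Integrable (M.detKernel z) s) {S : Finset Z} (hS : S ⊆ W) :
    Integrable (fun x => M.targetDensity x S) s := by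
  unfold targetDensity
  split_ifs
  · exact M.integrable_missKernel s
  · exact integrable_finsetSum _ fun z hz => hdet z (hS hz)
  · exact integrable_zero _ _ _

theorem clutterDensity_nonneg (S : Finset Z) : 0 ≤ M.clutterDensity S :=
  mul_nonneg (by positivity) (Finset.prod_nonneg fun z _ => M.c_nonneg z)

variable [DecidableEq Z]

theorem likelihood_cons (V : Finset Z) (x : X) (ξ : Config X) :
    M.likelihood V (x ::ₘ ξ) =
      superpose (M.targetDensity x) (fun S => M.likelihood S ξ) V := by
  simp only [likelihood, Multiset.foldr_cons]

theorem likelihood_nonneg (V : Finset Z) (ξ : Config X) : 0 ≤ M.likelihood V ξ := by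
  induction ξ using Multiset.induction generalizing V with
  | empty => exact M.clutterDensity_nonneg V
  | cons x ξ ih =>
    rw [likelihood_cons]
    exact Finset.sum_nonneg fun S _ => mul_nonneg (M.targetDensity_nonneg x S) (ih _)

theorem likelihood_ofTuple_zero (V : Finset Z) (x : Fin 0 → X) :
    M.likelihood V (ofTuple x) = M.clutterDensity V := rfl

theorem measurable_likelihood (V : Finset Z) : Measurable (M.likelihood V) := by
  refine measurable_config fun n => ?_
  induction n generalizing V with
  | zero => exact measurable_const
  | succ n ih =>
    simp only [ofTuple_succ, likelihood_cons, superpose]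
    exact Finset.measurable_sum _ fun S _ =>
      ((M.measurable_targetDensity S).comp (measurable_pi_apply 0)).mul
        ((ih _).comp (measurable_pi_lambda _ fun i => measurable_pi_apply i.succ))

end Densities

/-! ### Moments weighted by the likelihood, for a fixed number of targets. -/

section Integrals

variable [DecidableEq Z] (M : Sensor X Z) (s : Measure X)

/-- Multi-object density of the measurements of a random target with law `s` when it is in `B`. -/
noncomputable def regionDensity (B : Set X) (S : Finset Z) : ℝ := ∫ x in B, M.targetDensity x S ∂s

/-- Multi-object density of the measurements of `n` random targets and the clutter. -/
noncomputable def predictedDensity (n : ℕ) : Finset Z → ℝ :=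
  (superpose (M.regionDensity s Set.univ))^[n] M.clutterDensity

theorem predictedDensity_succ (n : ℕ) : M.predictedDensity s (n + 1) =
    superpose (M.regionDensity s Set.univ) (M.predictedDensity s n) :=
  Function.iterate_succ_apply' _ _ _

variable {s} [IsProbabilityMeasure s]

/-- The induction step shared by all the moments: after splitting off the first target, the
integrand is a finite sum of products, to which Fubini applies. The weights `f` and `w` allow either
the first target or the others to be counted. -/
theorem integrable_integral_likelihood_succ {n : ℕ} {f : X → ℝ} {w : (Fin n → X) → ℝ}
    {τ g : Finset Z → ℝ} {V : Finset Z}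
    (hf : ∀ S ⊆ V, Integrable (fun x => f x * M.targetDensity x S) s ∧
      ∫ x, f x * M.targetDensity x S ∂s = τ S)
    (hw : ∀ S ⊆ V, Integrable (fun x => w x * M.likelihood S (ofTuple x))
      (Measure.pi fun _ => s) ∧
      ∫ x, w x * M.likelihood S (ofTuple x) ∂(Measure.pi fun _ => s) = g S) :
    Integrable (fun x : Fin (n + 1) → X => f (x 0) * (w fun i => x i.succ) *
      M.likelihood V (x 0 ::ₘ ofTuple fun i => x i.succ)) (Measure.pi fun _ => s) ∧
    ∫ x : Fin (n + 1) → X, f (x 0) * (w fun i => x i.succ) *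
      M.likelihood V (x 0 ::ₘ ofTuple fun i => x i.succ) ∂(Measure.pi fun _ => s) =
    superpose τ g V := by
  have hfun : (fun x : Fin (n + 1) → X => f (x 0) * (w fun i => x i.succ) *
      M.likelihood V (x 0 ::ₘ ofTuple fun i => x i.succ)) = fun x => ∑ S ∈ V.powerset,
        (f (x 0) * M.targetDensity (x 0) S) *
          ((w fun i => x i.succ) * M.likelihood (V \ S) (ofTuple fun i => x i.succ)) := by
    funext x
    rw [likelihood_cons, superpose, Finset.mul_sum]
    exact Finset.sum_congr rfl fun S _ => by ring
  have h := fun S (hS : S ∈ V.powerset) => integrable_integral_pi_succ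
    (hf S (Finset.mem_powerset.1 hS)).1 (hw (V \ S) Finset.sdiff_subset).1
  rw [hfun]
  refine ⟨integrable_finsetSum _ fun S hS => (h S hS).1, ?_⟩
  rw [integral_finsetSum _ fun S hS => (h S hS).1]
  refine Finset.sum_congr rfl fun S hS => ?_
  rw [(h S hS).2, (hf S (Finset.mem_powerset.1 hS)).2, (hw _ Finset.sdiff_subset).2]

variable {W : Finset Z} (hdet : ∀ z ∈ W, Integrable (M.detKernel z) s)
include hdet

omit [DecidableEq Z] in
theorem integrable_integral_targetDensity {S : Finset Z} (hS : S ⊆ W) :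
    Integrable (fun x => 1 * M.targetDensity x S) s ∧
      ∫ x, 1 * M.targetDensity x S ∂s = M.regionDensity s Set.univ S := by
  simp only [one_mul, regionDensity, setIntegral_univ, and_true]
  exact M.integrable_targetDensity hdet hS

theorem integrable_integral_likelihood (n : ℕ) : ∀ V ⊆ W,
    Integrable (fun x : Fin n → X => 1 * M.likelihood V (ofTuple x)) (Measure.pi fun _ => s) ∧
    ∫ x : Fin n → X, 1 * M.likelihood V (ofTuple x) ∂(Measure.pi fun _ => s) =
      M.predictedDensity s n V := by
  induction n with
  | zero =>
    intro V _
    simp [likelihood_ofTuple_zero, predictedDensity]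
  | succ n ih =>
    intro V hV
    have h := M.integrable_integral_likelihood_succ (f := fun _ => 1) (w := fun _ => 1) (n := n)
      (V := V) (s := s) (fun S hS => M.integrable_integral_targetDensity hdet (hS.trans hV))
      (fun S hS => ih S (hS.trans hV))
    simpa only [ofTuple_succ, one_mul, predictedDensity_succ] using h

variable {B : Set X} (hB : MeasurableSet B)
include hB

omit [DecidableEq Z] in
theorem integrable_integral_indicator_mul_targetDensity {S : Finset Z} (hS : S ⊆ W) :
    Integrable (fun x => B.indicator (fun _ => (1 : ℝ)) x * M.targetDensity x S) s ∧
      ∫ x, B.indicator (fun _ => (1 : ℝ)) x * M.targetDensity x S ∂s =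
        M.regionDensity s B S := by
  have h : (fun x => B.indicator (fun _ => (1 : ℝ)) x * M.targetDensity x S) =
      B.indicator fun x => M.targetDensity x S := by
    funext x
    by_cases hx : x ∈ B <;> simp [hx]
  rw [h, regionDensity, integral_indicator hB]
  exact ⟨(M.integrable_targetDensity hdet hS).indicator hB, rfl⟩

/-- By symmetry each of the `n` targets contributes equally to the count. In the induction, `h₁`
counts the first target and `h₂` the others. -/
theorem integrable_integral_count_mul_likelihood (n : ℕ) : ∀ V ⊆ W,
    Integrable (fun x : Fin n → X => count B (ofTuple x) * M.likelihood V (ofTuple x))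
      (Measure.pi fun _ => s) ∧
    ∫ x : Fin n → X, count B (ofTuple x) * M.likelihood V (ofTuple x) ∂(Measure.pi fun _ => s) =
      ((n : ℝ) • superpose (M.regionDensity s B) (M.predictedDensity s (n - 1))) V := by
  induction n with
  | zero =>
    intro V _
    simp [count_ofTuple]
  | succ n ih =>
    intro V hV
    have h₁ := M.integrable_integral_likelihood_succ (f := B.indicator fun _ => (1 : ℝ))
      (w := fun _ => 1) (n := n) (V := V) (s := s)
      (fun S hS => M.integrable_integral_indicator_mul_targetDensity hdet hB (hS.trans hV))
      (fun S hS => M.integrable_integral_likelihood hdet n S (hS.trans hV))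
    have h₂ := M.integrable_integral_likelihood_succ (f := fun _ => 1)
      (w := fun x => count B (ofTuple x)) (n := n) (V := V) (s := s)
      (fun S hS => M.integrable_integral_targetDensity hdet (hS.trans hV))
      (fun S hS => ih S (hS.trans hV))
    simp only [ofTuple_succ, count_cons, add_mul, mul_one, one_mul] at h₁ h₂ ⊢
    refine ⟨h₁.1.add h₂.1, ?_⟩
    rw [integral_add h₁.1 h₂.1, h₁.2, h₂.2, superpose_smul]
    -- At zero the truncated `n - 1` is meaningless but has coefficient zero. Otherwise commuting
    -- the factors lets `predictedDensity` absorb the uncounted target.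
    rcases n with _ | n
    · simp
    · rw [superpose_left_comm, ← predictedDensity_succ]
      simp
      ring

theorem integrable_integral_count_mul_count_sub_one_mul_likelihood (n : ℕ) : ∀ V ⊆ W,
    Integrable (fun x : Fin n → X => count B (ofTuple x) * (count B (ofTuple x) - 1) *
      M.likelihood V (ofTuple x)) (Measure.pi fun _ => s) ∧
    ∫ x : Fin n → X, count B (ofTuple x) * (count B (ofTuple x) - 1) *
      M.likelihood V (ofTuple x) ∂(Measure.pi fun _ => s) =
      ((n * (n - 1) : ℝ) • superpose (M.regionDensity s B) (superpose (M.regionDensity s B)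
        (M.predictedDensity s (n - 2)))) V := by
  induction n with
  | zero =>
    intro V _
    simp [count_ofTuple]
  | succ n ih =>
    intro V hV
    have h₁ := M.integrable_integral_likelihood_succ (f := B.indicator fun _ => (1 : ℝ))
      (w := fun x => count B (ofTuple x)) (n := n) (V := V) (s := s)
      (fun S hS => M.integrable_integral_indicator_mul_targetDensity hdet hB (hS.trans hV))
      (fun S hS => M.integrable_integral_count_mul_likelihood hdet hB n S (hS.trans hV))
    have h₂ := M.integrable_integral_likelihood_succ (f := fun _ => 1)
      (w := fun x => count B (ofTuple x) * (count B (ofTuple x) - 1)) (n := n) (V := V) (s := s)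
      (fun S hS => M.integrable_integral_targetDensity hdet (hS.trans hV))
      (fun S hS => ih S (hS.trans hV))
    -- With `ε ∈ {0, 1}` the indicator of the first target, `(ε + N)(ε + N - 1) = 2 ε N + N (N -
    -- 1)`. The coefficients then add up as `2 n + n (n - 1) = (n + 1) n`.
    have hfun : (fun x : Fin (n + 1) → X => count B (ofTuple x) * (count B (ofTuple x) - 1) *
        M.likelihood V (ofTuple x)) = fun x => 2 * (B.indicator (fun _ => (1 : ℝ)) (x 0) *
          count B (ofTuple fun i => x i.succ) *
            M.likelihood V (x 0 ::ₘ ofTuple fun i => x i.succ)) +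
        1 * (count B (ofTuple fun i => x i.succ) * (count B (ofTuple fun i => x i.succ) - 1)) *
          M.likelihood V (x 0 ::ₘ ofTuple fun i => x i.succ) := by
      funext x
      rw [ofTuple_succ, count_cons]
      by_cases hx : x 0 ∈ B <;> simp only [hx, Set.indicator_of_mem, Set.indicator_of_notMem,
        not_false_eq_true] <;> ring
    rw [hfun]
    refine ⟨(h₁.1.const_mul 2).add h₂.1, ?_⟩
    rw [integral_add (h₁.1.const_mul 2) h₂.1, integral_const_mul, h₁.2, h₂.2, superpose_smul,
      superpose_smul]
    rcases n with _ | _ | n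
    · simp
    · norm_num
    · rw [superpose_left_comm (M.regionDensity s Set.univ),
        superpose_left_comm (M.regionDensity s Set.univ), ← predictedDensity_succ]
      simp
      ring

end Integrals

end Sensor

/-! ### Integration against an i.i.d. law. -/

section IIDLaw

variable {X : Type*} [MeasurableSpace X] (ρ : PMF ℕ) (s : Measure X)

theorem lintegral_iidLaw {g : Config X → ℝ≥0∞} (hg : Measurable g) :
    ∫⁻ ξ, g ξ ∂(iidLaw ρ s) =
      ∑' n : ℕ, ρ n * ∫⁻ x : Fin n → X, g (ofTuple x) ∂(Measure.pi fun _ => s) := by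
  rw [iidLaw, lintegral_sum_measure]
  refine tsum_congr fun n => ?_
  rw [lintegral_smul_measure, lintegral_map hg (measurable_ofTuple n), smul_eq_mul]

theorem iidLaw_congr_of_eq_zero {s' : Measure X} [SigmaFinite s] [SigmaFinite s']
    (hρ : ∀ n, n ≠ 0 → ρ n = 0) : iidLaw ρ s = iidLaw ρ s' := by
  unfold iidLaw
  congr 1
  funext n
  rcases n with _ | n
  · congr 2
    rw [Measure.pi_of_empty, Measure.pi_of_empty]
  · simp [hρ (n + 1) n.succ_ne_zero]

section NonnegIntegrals

variable {ρ s} {g : Config X → ℝ} {j : ℕ → ℝ}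

/-- Working in `ℝ≥0∞` requires no summability, so this formula yields both the integrability
criterion and the value of the integral. -/
theorem lintegral_ofReal_iidLaw (hg : Measurable g) (hg0 : ∀ ξ, 0 ≤ g ξ)
    (hj : ∀ n, Integrable (fun x : Fin n → X => g (ofTuple x)) (Measure.pi fun _ => s) ∧
      ∫ x : Fin n → X, g (ofTuple x) ∂(Measure.pi fun _ => s) = j n) :
    ∫⁻ ξ, ENNReal.ofReal (g ξ) ∂(iidLaw ρ s) = ∑' n, ENNReal.ofReal (j n * (ρ n).toReal) := by
  rw [lintegral_iidLaw ρ s hg.ennreal_ofReal]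
  refine tsum_congr fun n => ?_
  rw [← ofReal_integral_eq_lintegral_ofReal (hj n).1 (Filter.Eventually.of_forall fun _ => hg0 _),
    (hj n).2, mul_comm (j n), ENNReal.ofReal_mul ENNReal.toReal_nonneg,
    ENNReal.ofReal_toReal (ρ.apply_ne_top n)]

theorem integrable_iidLaw_iff (hg : Measurable g) (hg0 : ∀ ξ, 0 ≤ g ξ)
    (hj : ∀ n, Integrable (fun x : Fin n → X => g (ofTuple x)) (Measure.pi fun _ => s) ∧
      ∫ x : Fin n → X, g (ofTuple x) ∂(Measure.pi fun _ => s) = j n) :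
    Integrable g (iidLaw ρ s) ↔ Summable fun n => j n * (ρ n).toReal := by
  have hj0 : ∀ n, 0 ≤ j n * (ρ n).toReal := fun n => by
    rw [← (hj n).2]
    exact mul_nonneg (integral_nonneg fun _ => hg0 _) ENNReal.toReal_nonneg
  rw [Integrable, hasFiniteIntegral_iff_ofReal (Filter.Eventually.of_forall hg0),
    lintegral_ofReal_iidLaw hg hg0 hj, and_iff_right hg.aestronglyMeasurable]
  constructor
  · intro h
    exact (ENNReal.summable_toReal h.ne).congr fun n => ENNReal.toReal_ofReal (hj0 n)
  · intro h
    rw [← ENNReal.ofReal_tsum_of_nonneg hj0 h]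
    exact ENNReal.ofReal_lt_top

theorem integral_iidLaw (hg : Measurable g) (hg0 : ∀ ξ, 0 ≤ g ξ)
    (hj : ∀ n, Integrable (fun x : Fin n → X => g (ofTuple x)) (Measure.pi fun _ => s) ∧
      ∫ x : Fin n → X, g (ofTuple x) ∂(Measure.pi fun _ => s) = j n)
    (hs : Summable fun n => j n * (ρ n).toReal) :
    ∫ ξ, g ξ ∂(iidLaw ρ s) = ∑' n, j n * (ρ n).toReal := by
  have hj0 : ∀ n, 0 ≤ j n * (ρ n).toReal := fun n => by
    rw [← (hj n).2]
    exact mul_nonneg (integral_nonneg fun _ => hg0 _) ENNReal.toReal_nonneg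
  rw [integral_eq_lintegral_of_nonneg_ae (Filter.Eventually.of_forall hg0)
    hg.aestronglyMeasurable, lintegral_ofReal_iidLaw hg hg0 hj,
    ← ENNReal.ofReal_tsum_of_nonneg hj0 hs, ENNReal.toReal_ofReal (tsum_nonneg hj0)]

end NonnegIntegrals

theorem eq_smul_of_isFirstMomentMeasure_iidLaw [IsProbabilityMeasure s] {μ : Measure X}
    (hμ : IsFirstMomentMeasure (iidLaw ρ s) μ) : μ = (∑' n : ℕ, (n : ℝ≥0∞) * ρ n) • s := by
  ext B hB
  rw [hμ B hB, lintegral_iidLaw ρ s (measurable_count hB).ennreal_ofReal, Measure.smul_apply,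
    smul_eq_mul, ← ENNReal.tsum_mul_right]
  refine tsum_congr fun n => ?_
  have h : ∀ x : Fin n → X, ENNReal.ofReal (count B (ofTuple x)) =
      ∑ i, B.indicator (fun _ => (1 : ℝ≥0∞)) (x i) := by
    intro x
    rw [count_ofTuple, ENNReal.ofReal_sum_of_nonneg fun i _ =>
      Set.indicator_nonneg (fun _ _ => zero_le_one) _]
    refine Finset.sum_congr rfl fun i _ => ?_
    by_cases hx : x i ∈ B <;> simp [hx]
  have hi : ∀ i : Fin n, ∫⁻ x : Fin n → X, B.indicator (fun _ => (1 : ℝ≥0∞)) (x i)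
      ∂(Measure.pi fun _ => s) = s B := by
    intro i
    rw [(measurePreserving_eval (fun _ : Fin n => s) i).lintegral_comp
      (measurable_const.indicator hB), lintegral_indicator hB]
    simp
  have hm : ∀ i : Fin n, Measurable fun x : Fin n → X => B.indicator (fun _ => (1 : ℝ≥0∞)) (x i) :=
    fun i => (measurable_const.indicator hB).comp (measurable_pi_apply i)
  simp only [h]
  rw [lintegral_finsetSum _ fun i _ => hm i]
  simp only [hi, Finset.sum_const, Finset.card_univ, Fintype.card_fin, nsmul_eq_mul]
  ring

end IIDLaw

namespace Sensor

variable {X Z : Type*} [MeasurableSpace X] (M : Sensor X Z)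

/-! ### Integration against the updated law. -/

section Bayes

variable [DecidableEq Z] {P : Measure (Config X)} {W : Finset Z}

theorem isProbabilityMeasure_update (h0 : M.evidence P W ≠ 0) (htop : M.evidence P W ≠ ∞) :
    IsProbabilityMeasure (M.update P W) := by
  constructor
  rw [update, Measure.smul_apply, withDensity_apply _ MeasurableSet.univ, Measure.restrict_univ]
  exact ENNReal.inv_mul_cancel h0 htop

theorem integrable_update_iff (h0 : M.evidence P W ≠ 0) (htop : M.evidence P W ≠ ∞)
    {g : Config X → ℝ} :
    Integrable g (M.update P W) ↔ Integrable (fun ξ => g ξ * M.likelihood W ξ) P := by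
  rw [update, integrable_smul_measure (ENNReal.inv_ne_zero.2 htop) (ENNReal.inv_ne_top.2 h0),
    integrable_withDensity_iff (M.measurable_likelihood W).ennreal_ofReal
      (Filter.Eventually.of_forall fun _ => ENNReal.ofReal_lt_top)]
  simp only [ENNReal.toReal_ofReal (M.likelihood_nonneg W _)]

theorem integral_update (g : Config X → ℝ) :
    ∫ ξ, g ξ ∂(M.update P W) =
      (∫ ξ, g ξ * M.likelihood W ξ ∂P) / (M.evidence P W).toReal := by
  rw [update, integral_smul_measure, integral_withDensity_eq_integral_toReal_smul
    (M.measurable_likelihood W).ennreal_ofReal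
      (Filter.Eventually.of_forall fun _ => ENNReal.ofReal_lt_top)]
  simp only [ENNReal.toReal_ofReal (M.likelihood_nonneg W _), smul_eq_mul, ENNReal.toReal_inv,
    mul_comm (M.likelihood W _)]
  rw [div_eq_inv_mul]

end Bayes

/-! ### Identification with the `Υ` functions. -/

section ClosedForms

variable (s : Measure X)

theorem missMass_nonneg (B : Set X) : 0 ≤ M.missMass s B := integral_nonneg M.missKernel_nonneg

theorem detMass_nonneg (z : Z) (B : Set X) : 0 ≤ M.detMass s z B :=
  integral_nonneg (M.detKernel_nonneg z)

theorem regionDensity_empty (B : Set X) : M.regionDensity s B ∅ = M.missMass s B := by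
  simp only [regionDensity, targetDensity_empty, missMass]

theorem regionDensity_singleton (B : Set X) (z : Z) :
    M.regionDensity s B {z} = M.detMass s z B := by
  simp only [regionDensity, targetDensity_singleton, detMass]

theorem regionDensity_eq_zero (B : Set X) (S : Finset Z) (hS : 2 ≤ S.card) :
    M.regionDensity s B S = 0 := by
  simp [regionDensity, M.targetDensity_eq_zero _ hS]

theorem superpose_regionDensity [DecidableEq Z] (B : Set X) (g : Finset Z → ℝ) (V : Finset Z) :
    superpose (M.regionDensity s B) g V =
      M.missMass s B * g V + ∑ z ∈ V, M.detMass s z B * g (V \ {z}) := by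
  rw [superpose_eq_of_card_le_one (M.regionDensity_eq_zero s B), regionDensity_empty]
  simp only [regionDensity_singleton]

/-- Terms with `d > n` vanish, so the range can be made independent of `n`; the denominator is one
for a probability measure. -/
theorem upsilon_eq_sum_range_card [IsProbabilityMeasure s] (u : ℕ) (V : Finset Z) (n : ℕ) :
    M.upsilon s u V n = ∑ d ∈ Finset.range (V.card + 1),
      ((V.card - d)! * (M.ρc (V.card - d)).toReal * M.esymm s d V) *
        (n.descFactorial (d + u) * M.missMass s Set.univ ^ (n - (d + u))) := by
  have hsub : Finset.range (min V.card n + 1) ⊆ Finset.range (V.card + 1) :=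
    Finset.range_subset_range.2 (by omega)
  rw [upsilon, ← Finset.sum_subset hsub]
  · refine Finset.sum_congr rfl fun d _ => ?_
    rw [probReal_univ]
    ring
  · intro d hd hd'
    rw [Finset.mem_range] at hd hd'
    rw [Nat.descFactorial_of_lt (by omega)]
    simp

theorem upsilon_nonneg [IsProbabilityMeasure s] (u : ℕ) (V : Finset Z) (n : ℕ) :
    0 ≤ M.upsilon s u V n := by
  rw [upsilon_eq_sum_range_card]
  refine Finset.sum_nonneg fun d _ => mul_nonneg (mul_nonneg (by positivity) ?_)
    (mul_nonneg (by positivity) (pow_nonneg (M.missMass_nonneg s _) _))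
  exact Finset.sum_nonneg fun S _ => Finset.prod_nonneg fun z _ =>
    div_nonneg (M.detMass_nonneg s z _) (M.c_nonneg z)

variable [DecidableEq Z] {W : Finset Z} (hc : ∀ z ∈ W, 0 < M.c z) [IsProbabilityMeasure s]
include hc

/-- Choosing `u` counted targets and then `d` matched ones among the other `n - u` amounts to
arranging `d + u` targets among `n`. This is the origin of the shift by `u` in `upsilon`. -/
theorem descFactorial_mul_predictedDensity (u n : ℕ) {V : Finset Z} (hV : V ⊆ W) :
    n.descFactorial u * M.predictedDensity s (n - u) V =
      (∏ z ∈ V, M.c z) * M.upsilon s u V n := by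
  rw [predictedDensity, iterate_superpose_eq (κ := M.clutterDensity)
    (M.regionDensity_eq_zero s _) (r := fun j => j ! * (M.ρc j).toReal) (fun _ => rfl) hc _ V hV, upsilon_eq_sum_range_card,
    matchingSum, mul_left_comm, Finset.mul_sum]
  congr 1
  refine Finset.sum_congr rfl fun d _ => ?_
  have h := Nat.descFactorial_mul_descFactorial (n := n) (Nat.le_add_left u d)
  rw [Nat.add_sub_cancel] at h
  rw [← h, Nat.sub_sub, add_comm u d]
  simp only [regionDensity_empty, regionDensity_singleton, esymm]
  push_cast
  ring

theorem prod_c_sdiff_singleton {V : Finset Z} (hV : V ⊆ W) {z : Z} (hz : z ∈ V) :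
    ∏ y ∈ V \ {z}, M.c y = (∏ y ∈ V, M.c y) / M.c z := by
  rw [Finset.sdiff_singleton_eq_erase, ← Finset.mul_prod_erase V _ hz,
    mul_div_cancel_left₀ _ (hc z (hV hz)).ne']

/-- Closed form of `∫ N(B) L(W|x) ds^n`. -/
theorem superpose_regionDensity_predictedDensity (B : Set X) (u n : ℕ) {V : Finset Z}
    (hV : V ⊆ W) :
    n.descFactorial u * superpose (M.regionDensity s B) (M.predictedDensity s (n - u)) V =
      (∏ z ∈ V, M.c z) * (M.missMass s B * M.upsilon s u V n +
        ∑ z ∈ V, M.detMass s z B / M.c z * M.upsilon s u (V \ {z}) n) := by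
  rw [superpose_regionDensity, mul_add, mul_add, mul_left_comm,
    M.descFactorial_mul_predictedDensity s hc u n hV, mul_left_comm, Finset.mul_sum,
    Finset.mul_sum]
  congr 1
  refine Finset.sum_congr rfl fun z hz => ?_
  rw [mul_left_comm, M.descFactorial_mul_predictedDensity s hc u n (Finset.sdiff_subset.trans hV),
    M.prod_c_sdiff_singleton hc hV hz]
  ring

/-- Closed form of `∫ N(B) (N(B) - 1) L(W|x) ds^n`. -/
theorem superpose_regionDensity_regionDensity_predictedDensity (B : Set X) (u n : ℕ) :
    n.descFactorial u * superpose (M.regionDensity s B)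
        (superpose (M.regionDensity s B) (M.predictedDensity s (n - u))) W =
      (∏ z ∈ W, M.c z) * (M.missMass s B ^ 2 * M.upsilon s u W n +
        2 * M.missMass s B * ∑ z ∈ W, M.detMass s z B / M.c z * M.upsilon s u (W \ {z}) n +
        ∑ z ∈ W, ∑ z' ∈ W, (M.detMass s z B / M.c z) * (M.detMass s z' B / M.c z') *
          if z ≠ z' then M.upsilon s u (W \ {z, z'}) n else 0) := by
  -- One measurement cannot come from two targets: the second sum runs over `W \ {z}`, which is why
  -- the diagonal is absent.
  have hinner : ∀ z ∈ W, ∑ z' ∈ W, (M.detMass s z B / M.c z) * (M.detMass s z' B / M.c z') *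
        (if z ≠ z' then M.upsilon s u (W \ {z, z'}) n else 0) =
      M.detMass s z B / M.c z * ∑ z' ∈ W \ {z}, M.detMass s z' B / M.c z' *
        M.upsilon s u ((W \ {z}) \ {z'}) n := by
    intro z hz
    rw [Finset.sdiff_singleton_eq_erase, ← Finset.add_sum_erase W _ hz, Finset.mul_sum]
    simp only [ne_eq, not_true_eq_false, if_false, mul_zero, zero_add]
    refine Finset.sum_congr rfl fun z' hz' => ?_
    rw [if_pos (Finset.ne_of_mem_erase hz').symm, ← Finset.sdiff_singleton_eq_erase, sdiff_sdiff,
      Finset.sup_eq_union, ← Finset.insert_eq, mul_assoc]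
  have houter : ∀ z ∈ W, n.descFactorial u * (M.detMass s z B *
        superpose (M.regionDensity s B) (M.predictedDensity s (n - u)) (W \ {z})) =
      (∏ z ∈ W, M.c z) * (M.missMass s B * (M.detMass s z B / M.c z * M.upsilon s u (W \ {z}) n) +
        M.detMass s z B / M.c z * ∑ z' ∈ W \ {z}, M.detMass s z' B / M.c z' *
        M.upsilon s u ((W \ {z}) \ {z'}) n) := by
    intro z hz
    rw [mul_left_comm, M.superpose_regionDensity_predictedDensity s hc B u n Finset.sdiff_subset,
      M.prod_c_sdiff_singleton hc subset_rfl hz]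
    ring
  rw [superpose_regionDensity, mul_add, mul_left_comm,
    M.superpose_regionDensity_predictedDensity s hc B u n subset_rfl, Finset.mul_sum,
    Finset.sum_congr rfl houter, Finset.sum_congr rfl hinner, ← Finset.mul_sum,
    Finset.sum_add_distrib, ← Finset.mul_sum]
  ring

end ClosedForms

/-! ### Convergence of the series. -/

section Summability

variable (ρ : PMF ℕ) (s : Measure X)

theorem esymm_zero (V : Finset Z) : M.esymm s 0 V = 1 := by
  simp [esymm]

variable [IsProbabilityMeasure s]

theorem missMass_univ_le_one : M.missMass s Set.univ ≤ 1 := by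
  have h := integral_mono (M.integrable_missKernel s) (integrable_const (1 : ℝ))
    M.missKernel_le_one
  simpa [missMass] using h

/-- Missed mass one forces the nonnegative function `pd` to have integral zero, hence to vanish
almost everywhere. -/
theorem detMass_univ_eq_zero (h : M.missMass s Set.univ = 1) (z : Z) :
    M.detMass s z Set.univ = 0 := by
  have hpd : Integrable M.pd s := by
    have h := (integrable_const (1 : ℝ)).sub (M.integrable_missKernel s)
    refine h.congr (Filter.Eventually.of_forall fun x => ?_)
    simp [missKernel]
  have hz : ∫ x, M.pd x ∂s = 0 := by
    simp only [missMass, missKernel, setIntegral_univ] at h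
    rw [integral_sub (integrable_const _) hpd] at h
    simpa using h
  have hae := (integral_eq_zero_iff_of_nonneg M.pd_nonneg hpd).1 hz
  rw [detMass, setIntegral_univ]
  refine integral_eq_zero_of_ae ?_
  filter_upwards [hae] with x hx
  simp only [Pi.zero_apply] at hx ⊢
  rw [detKernel, hx, zero_mul]

theorem esymm_eq_zero (h : M.missMass s Set.univ = 1) {d : ℕ} (hd : d ≠ 0) (V : Finset Z) :
    M.esymm s d V = 0 := by
  refine Finset.sum_eq_zero fun S hS => ?_
  obtain ⟨z, hz⟩ := Finset.card_pos.1
    (show 0 < S.card by have := (Finset.mem_powersetCard.1 hS).2; omega)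
  exact Finset.prod_eq_zero hz (by rw [M.detMass_univ_eq_zero s h, zero_div])

theorem upsilon_of_missMass_eq_one (h : M.missMass s Set.univ = 1) (u : ℕ) (V : Finset Z)
    (n : ℕ) : M.upsilon s u V n = V.card ! * (M.ρc V.card).toReal * n.descFactorial u := by
  rw [upsilon_eq_sum_range_card, Finset.sum_eq_single_of_mem 0 (by simp)]
  · rw [M.esymm_zero, h]
    simp
  · intro d _ hd
    rw [M.esymm_eq_zero s h hd]
    simp

theorem toReal_pmf_le_one (n : ℕ) : (ρ n).toReal ≤ 1 :=
  ENNReal.toReal_le_of_le_ofReal zero_le_one (by simpa using ρ.coe_le_one n)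

/-- If the missed mass is below one, `upsilon` is itself summable in `n`, being dominated by
polynomial times geometric terms, and `ρ n ≤ 1`. Only missed mass one needs a factorial moment of
`ρ`, so the hypothesis is conditional. -/
theorem summable_upsilon {u : ℕ} (hu : M.missMass s Set.univ = 1 →
    Summable fun n : ℕ => (n.descFactorial u : ℝ) * (ρ n).toReal) (V : Finset Z) :
    Summable fun n => M.upsilon s u V n * (ρ n).toReal := by
  rcases (M.missMass_univ_le_one s).eq_or_lt with h | h
  · refine ((hu h).mul_left (V.card ! * (M.ρc V.card).toReal)).congr fun n => ?_
    rw [M.upsilon_of_missMass_eq_one s h]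
    ring
  · have ha := M.missMass_nonneg s Set.univ
    have hk : ∀ k : ℕ, Summable fun n : ℕ =>
        (n.descFactorial k : ℝ) * M.missMass s Set.univ ^ (n - k) := by
      intro k
      rw [← summable_nat_add_iff k]
      simpa using summable_descFactorial_mul_geometric_of_norm_lt_one k
        (show ‖M.missMass s Set.univ‖ < 1 by rwa [Real.norm_of_nonneg ha])
    have hsum : Summable fun n => M.upsilon s u V n := by
      simp only [upsilon_eq_sum_range_card]
      exact summable_sum fun d _ => (hk (d + u)).mul_left _
    exact Summable.of_nonneg_of_le
      (fun n => mul_nonneg (M.upsilon_nonneg s u V n) ENNReal.toReal_nonneg)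
      (fun n => mul_le_of_le_one_right (M.upsilon_nonneg s u V n) (toReal_pmf_le_one ρ n)) hsum

end Summability

end Sensor

namespace Sensor

variable {X Z : Type*} [MeasurableSpace X]

/-! ### Passage from the law of one point to the first moment measure. -/

section Rescaling

variable (M : Sensor X Z) (s : Measure X) (r : ℝ≥0∞)

theorem missMass_smul (B : Set X) : M.missMass (r • s) B = r.toReal * M.missMass s B := by
  rw [missMass, missMass, Measure.restrict_smul, integral_smul_measure, smul_eq_mul]

theorem detMass_smul (z : Z) (B : Set X) :
    M.detMass (r • s) z B = r.toReal * M.detMass s z B := by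
  rw [detMass, detMass, Measure.restrict_smul, integral_smul_measure, smul_eq_mul]

theorem esymm_smul (d : ℕ) (V : Finset Z) :
    M.esymm (r • s) d V = r.toReal ^ d * M.esymm s d V := by
  rw [esymm, esymm, Finset.mul_sum]
  refine Finset.sum_congr rfl fun S hS => ?_
  rw [← (Finset.mem_powersetCard.1 hS).2, ← Finset.prod_const, ← Finset.prod_mul_distrib]
  exact Finset.prod_congr rfl fun z _ => by rw [detMass_smul, mul_div_assoc]

variable [IsProbabilityMeasure s]

/-- Each term scales by `r ^ d` from `esymm`, `r ^ (n - (d + u))` from the missed mass and `r ^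
(-n)` from the denominator, in total `r ^ (-u)`. -/
theorem pow_mul_upsilon_smul (u : ℕ) (V : Finset Z) {n : ℕ} (h : n ≠ 0 → r.toReal ≠ 0) :
    r.toReal ^ u * M.upsilon (r • s) u V n = M.upsilon s u V n := by
  rw [upsilon, upsilon, Finset.mul_sum]
  refine Finset.sum_congr rfl fun d _ => ?_
  rcases lt_or_ge n (d + u) with hlt | hle
  · simp [Nat.descFactorial_of_lt hlt]
  rw [esymm_smul, missMass_smul, measureReal_ennreal_smul_apply, probReal_univ]
  -- For `n = 0` the factor `r` may vanish, but then `d = u = 0` and it occurs only to the power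
  -- zero.
  rcases eq_or_ne n 0 with rfl | hn
  · obtain ⟨rfl, rfl⟩ : d = 0 ∧ u = 0 := by omega
    simp
  · have hr := h hn
    obtain ⟨k, rfl⟩ := Nat.exists_eq_add_of_le hle
    rw [Nat.add_sub_cancel_left]
    field_simp
    ring

variable {r} {ρ : PMF ℕ} (hr : r.toReal = 0 → ∀ n, n ≠ 0 → ρ n = 0)
include hr

theorem pow_mul_upsilon_smul_mul (u : ℕ) (V : Finset Z) (n : ℕ) :
    r.toReal ^ u * (M.upsilon (r • s) u V n * (ρ n).toReal) =
      M.upsilon s u V n * (ρ n).toReal := by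
  by_cases h : n ≠ 0 ∧ r.toReal = 0
  · simp [hr h.2 n h.1]
  · rw [← mul_assoc, M.pow_mul_upsilon_smul s r u V fun hn h0 => h ⟨hn, h0⟩]

theorem summable_upsilon_smul {u : ℕ} {V : Finset Z}
    (h : Summable fun n => M.upsilon s u V n * (ρ n).toReal) :
    Summable fun n => M.upsilon (r • s) u V n * (ρ n).toReal := by
  by_cases h0 : r.toReal = 0
  · refine summable_of_ne_finset_zero (s := {0}) fun n hn => ?_
    rw [hr h0 n (by simpa using hn)]
    simp
  · rw [← summable_mul_left_iff (pow_ne_zero u h0)]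
    exact h.congr fun n => (M.pow_mul_upsilon_smul_mul s hr u V n).symm

theorem pow_mul_pairing_smul (u : ℕ) (V : Finset Z) :
    r.toReal ^ u * M.pairing (r • s) ρ u V = M.pairing s ρ u V := by
  rw [pairing, pairing, ← tsum_mul_left]
  exact tsum_congr fun n => M.pow_mul_upsilon_smul_mul s hr u V n

theorem pow_mul_corrector_smul (W : Finset Z) (u : ℕ) (V : Finset Z) :
    r.toReal ^ u * M.corrector (r • s) ρ W u V = M.corrector s ρ W u V := by
  rw [corrector, corrector, ← M.pow_mul_pairing_smul s hr 0 W, ← M.pow_mul_pairing_smul s hr u V,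
    pow_zero, one_mul, mul_div_assoc]

end Rescaling

theorem summable_descFactorial_zero_mul (ρ : PMF ℕ) :
    Summable fun n : ℕ => (n.descFactorial 0 : ℝ) * (ρ n).toReal := by
  simpa using ENNReal.summable_toReal ρ.tsum_coe_ne_top

theorem summable_upsilon_zero (M : Sensor X Z) (ρ : PMF ℕ) (s : Measure X)
    [IsProbabilityMeasure s] (V : Finset Z) :
    Summable fun n => M.upsilon s 0 V n * (ρ n).toReal :=
  M.summable_upsilon ρ s (fun _ => summable_descFactorial_zero_mul ρ) V

/-! ### Summation over the number of targets. -/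

section Moments

variable (M : Sensor X Z) {s : Measure X} {ρ : PMF ℕ}

theorem hasSum_upsilon_ite (hS : ∀ V, Summable fun n => M.upsilon s 2 V n * (ρ n).toReal)
    (p : Prop) [Decidable p] (V : Finset Z) :
    HasSum (fun n => (if p then M.upsilon s 2 V n else 0) * (ρ n).toReal)
      (if p then M.pairing s ρ 2 V else 0) := by
  split_ifs
  · exact (hS V).hasSum
  · simp

variable [DecidableEq Z] {W : Finset Z} {B : Set X}

theorem hasSum_first_moment (hS₁ : ∀ V, Summable fun n => M.upsilon s 1 V n * (ρ n).toReal) :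
    HasSum (fun n => (∏ z ∈ W, M.c z) * (M.missMass s B * M.upsilon s 1 W n +
        ∑ z ∈ W, M.detMass s z B / M.c z * M.upsilon s 1 (W \ {z}) n) * (ρ n).toReal)
      ((∏ z ∈ W, M.c z) * (M.missMass s B * M.pairing s ρ 1 W +
        ∑ z ∈ W, M.detMass s z B / M.c z * M.pairing s ρ 1 (W \ {z}))) := by
  have h := (((hS₁ W).hasSum.mul_left (M.missMass s B)).add
    (hasSum_sum fun z (_ : z ∈ W) =>
      (hS₁ (W \ {z})).hasSum.mul_left (M.detMass s z B / M.c z))).mul_left (∏ z ∈ W, M.c z)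
  simp only [mul_assoc, add_mul, Finset.sum_mul] at h ⊢
  exact h

theorem hasSum_second_factorial_moment
    (hS₂ : ∀ V, Summable fun n => M.upsilon s 2 V n * (ρ n).toReal) :
    HasSum (fun n => (∏ z ∈ W, M.c z) * (M.missMass s B ^ 2 * M.upsilon s 2 W n +
        2 * M.missMass s B * ∑ z ∈ W, M.detMass s z B / M.c z * M.upsilon s 2 (W \ {z}) n +
        ∑ z ∈ W, ∑ z' ∈ W, (M.detMass s z B / M.c z) * (M.detMass s z' B / M.c z') *
          if z ≠ z' then M.upsilon s 2 (W \ {z, z'}) n else 0) * (ρ n).toReal)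
      ((∏ z ∈ W, M.c z) * (M.missMass s B ^ 2 * M.pairing s ρ 2 W +
        2 * M.missMass s B * ∑ z ∈ W, M.detMass s z B / M.c z * M.pairing s ρ 2 (W \ {z}) +
        ∑ z ∈ W, ∑ z' ∈ W, (M.detMass s z B / M.c z) * (M.detMass s z' B / M.c z') *
          if z ≠ z' then M.pairing s ρ 2 (W \ {z, z'}) else 0)) := by
  have h := ((((hS₂ W).hasSum.mul_left (M.missMass s B ^ 2)).add
    ((hasSum_sum fun z (_ : z ∈ W) =>
      (hS₂ (W \ {z})).hasSum.mul_left (M.detMass s z B / M.c z)).mul_left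
        (2 * M.missMass s B))).add
    (hasSum_sum fun z (_ : z ∈ W) => hasSum_sum fun z' (_ : z' ∈ W) =>
      (M.hasSum_upsilon_ite hS₂ (z ≠ z') (W \ {z, z'})).mul_left
        ((M.detMass s z B / M.c z) * (M.detMass s z' B / M.c z')))).mul_left (∏ z ∈ W, M.c z)
  simp only [mul_assoc, add_mul, Finset.sum_mul] at h ⊢
  exact h

end Moments

/-! ### Mean and second moment of the updated process. -/

section Update

variable [DecidableEq Z] (M : Sensor X Z) {s : Measure X} [IsProbabilityMeasure s] {ρ : PMF ℕ}
  {W : Finset Z} (hc : ∀ z ∈ W, 0 < M.c z) (hdet : ∀ z ∈ W, Integrable (M.detKernel z) s)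

include hc hdet

theorem evidence_iidLaw : M.evidence (iidLaw ρ s) W =
    ENNReal.ofReal ((∏ z ∈ W, M.c z) * M.pairing s ρ 0 W) := by
  have hj : ∀ n, Integrable (fun x : Fin n → X => M.likelihood W (ofTuple x))
      (Measure.pi fun _ => s) ∧
      ∫ x : Fin n → X, M.likelihood W (ofTuple x) ∂(Measure.pi fun _ => s) =
        (∏ z ∈ W, M.c z) * M.upsilon s 0 W n := by
    intro n
    have h := M.integrable_integral_likelihood hdet n W subset_rfl
    have h' := M.descFactorial_mul_predictedDensity s hc 0 n (subset_refl W)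
    simp only [one_mul, Nat.descFactorial_zero, Nat.cast_one, Nat.sub_zero] at h h'
    rwa [← h']
  rw [evidence, lintegral_ofReal_iidLaw (M.measurable_likelihood W) (M.likelihood_nonneg W) hj,
    pairing, ← tsum_mul_left]
  simp only [mul_assoc]
  refine (ENNReal.ofReal_tsum_of_nonneg (fun n => ?_) ?_).symm
  · exact mul_nonneg (Finset.prod_nonneg fun z _ => M.c_nonneg z)
      (mul_nonneg (M.upsilon_nonneg s 0 W n) ENNReal.toReal_nonneg)
  · exact (M.summable_upsilon_zero ρ s W).mul_left _

theorem evidence_iidLaw_ne_top : M.evidence (iidLaw ρ s) W ≠ ∞ := by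
  rw [M.evidence_iidLaw hc hdet]
  exact ENNReal.ofReal_ne_top

theorem toReal_evidence_iidLaw (hev : M.evidence (iidLaw ρ s) W ≠ 0) :
    (M.evidence (iidLaw ρ s) W).toReal = (∏ z ∈ W, M.c z) * M.pairing s ρ 0 W := by
  rw [M.evidence_iidLaw hc hdet] at hev ⊢
  rw [ne_eq, ENNReal.ofReal_eq_zero, not_le] at hev
  exact ENNReal.toReal_ofReal hev.le

variable {B : Set X} (hB : MeasurableSet B)
include hB

theorem integrable_integral_count_mul_likelihood_eq_upsilon (n : ℕ) :
    Integrable (fun x : Fin n → X => count B (ofTuple x) * M.likelihood W (ofTuple x))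
      (Measure.pi fun _ => s) ∧
    ∫ x : Fin n → X, count B (ofTuple x) * M.likelihood W (ofTuple x) ∂(Measure.pi fun _ => s) =
      (∏ z ∈ W, M.c z) * (M.missMass s B * M.upsilon s 1 W n +
        ∑ z ∈ W, M.detMass s z B / M.c z * M.upsilon s 1 (W \ {z}) n) := by
  have h := M.integrable_integral_count_mul_likelihood hdet hB n W subset_rfl
  rw [Pi.smul_apply, smul_eq_mul] at h
  rwa [← M.superpose_regionDensity_predictedDensity s hc B 1 n subset_rfl, Nat.descFactorial_one]

theorem integrable_integral_count_mul_count_mul_likelihood_eq_upsilon (n : ℕ) :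
    Integrable (fun x : Fin n → X => count B (ofTuple x) * count B (ofTuple x) *
      M.likelihood W (ofTuple x)) (Measure.pi fun _ => s) ∧
    ∫ x : Fin n → X, count B (ofTuple x) * count B (ofTuple x) *
      M.likelihood W (ofTuple x) ∂(Measure.pi fun _ => s) =
      (∏ z ∈ W, M.c z) * (M.missMass s B ^ 2 * M.upsilon s 2 W n +
        2 * M.missMass s B * ∑ z ∈ W, M.detMass s z B / M.c z * M.upsilon s 2 (W \ {z}) n +
        ∑ z ∈ W, ∑ z' ∈ W, (M.detMass s z B / M.c z) * (M.detMass s z' B / M.c z') *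
          if z ≠ z' then M.upsilon s 2 (W \ {z, z'}) n else 0) +
      (∏ z ∈ W, M.c z) * (M.missMass s B * M.upsilon s 1 W n +
        ∑ z ∈ W, M.detMass s z B / M.c z * M.upsilon s 1 (W \ {z}) n) := by
  have h₁ := M.integrable_integral_count_mul_likelihood_eq_upsilon hc hdet hB n
  have h₂ := M.integrable_integral_count_mul_count_sub_one_mul_likelihood hdet hB n W subset_rfl
  rw [Pi.smul_apply, smul_eq_mul, ← Nat.cast_descFactorial_two,
    M.superpose_regionDensity_regionDensity_predictedDensity s hc B 2 n] at h₂
  have hfun : (fun x : Fin n → X => count B (ofTuple x) * count B (ofTuple x) *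
      M.likelihood W (ofTuple x)) = fun x => count B (ofTuple x) * (count B (ofTuple x) - 1) *
        M.likelihood W (ofTuple x) + count B (ofTuple x) * M.likelihood W (ofTuple x) := by
    funext x
    ring
  rw [hfun]
  exact ⟨h₂.1.add h₁.1, by rw [integral_add h₂.1 h₁.1, h₂.2, h₁.2]⟩

variable (hev : M.evidence (iidLaw ρ s) W ≠ 0)
include hev

theorem integrable_count_update
    (hS₁ : ∀ V, Summable fun n => M.upsilon s 1 V n * (ρ n).toReal) :
    Integrable (count B) (M.update (iidLaw ρ s) W) := by
  rw [M.integrable_update_iff hev (M.evidence_iidLaw_ne_top hc hdet),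
    integrable_iidLaw_iff (g := fun ξ => count B ξ * M.likelihood W ξ)
      ((measurable_count hB).mul (M.measurable_likelihood W))
      (fun ξ => mul_nonneg (count_nonneg B ξ) (M.likelihood_nonneg W ξ))
      (M.integrable_integral_count_mul_likelihood_eq_upsilon hc hdet hB)]
  exact (M.hasSum_first_moment hS₁).summable

theorem mean_update_iidLaw
    (hS₁ : ∀ V, Summable fun n => M.upsilon s 1 V n * (ρ n).toReal) :
    mean (M.update (iidLaw ρ s) W) B = M.missMass s B * M.corrector s ρ W 1 W +
      ∑ z ∈ W, M.detMass s z B / M.c z * M.corrector s ρ W 1 (W \ {z}) := by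
  have hC : (∏ z ∈ W, M.c z) ≠ 0 := Finset.prod_ne_zero_iff.2 fun z hz => (hc z hz).ne'
  have hs := M.hasSum_first_moment (B := B) (W := W) hS₁
  rw [mean, integral_update, M.toReal_evidence_iidLaw hc hdet hev,
    integral_iidLaw (g := fun ξ => count B ξ * M.likelihood W ξ)
      ((measurable_count hB).mul (M.measurable_likelihood W))
      (fun ξ => mul_nonneg (count_nonneg B ξ) (M.likelihood_nonneg W ξ))
      (M.integrable_integral_count_mul_likelihood_eq_upsilon hc hdet hB) hs.summable,
    hs.tsum_eq, mul_div_mul_left _ _ hC, add_div, Finset.sum_div]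
  simp only [mul_div_assoc, corrector]

theorem memLp_count_update_iff :
    MemLp (count B) 2 (M.update (iidLaw ρ s) W) ↔
      Summable fun n => ((∏ z ∈ W, M.c z) * (M.missMass s B ^ 2 * M.upsilon s 2 W n +
        2 * M.missMass s B * ∑ z ∈ W, M.detMass s z B / M.c z * M.upsilon s 2 (W \ {z}) n +
        ∑ z ∈ W, ∑ z' ∈ W, (M.detMass s z B / M.c z) * (M.detMass s z' B / M.c z') *
          if z ≠ z' then M.upsilon s 2 (W \ {z, z'}) n else 0) +
      (∏ z ∈ W, M.c z) * (M.missMass s B * M.upsilon s 1 W n +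
        ∑ z ∈ W, M.detMass s z B / M.c z * M.upsilon s 1 (W \ {z}) n)) * (ρ n).toReal := by
  rw [memLp_two_iff_integrable_sq (measurable_count hB).aestronglyMeasurable,
    M.integrable_update_iff hev (M.evidence_iidLaw_ne_top hc hdet)]
  simp only [pow_two (count B _)]
  exact integrable_iidLaw_iff
    (((measurable_count hB).mul (measurable_count hB)).mul (M.measurable_likelihood W))
    (fun ξ => mul_nonneg (mul_self_nonneg _) (M.likelihood_nonneg W ξ))
    (M.integrable_integral_count_mul_count_mul_likelihood_eq_upsilon hc hdet hB)

theorem memLp_count_update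
    (hS₁ : ∀ V, Summable fun n => M.upsilon s 1 V n * (ρ n).toReal)
    (hS₂ : ∀ V, Summable fun n => M.upsilon s 2 V n * (ρ n).toReal) :
    MemLp (count B) 2 (M.update (iidLaw ρ s) W) := by
  rw [M.memLp_count_update_iff hc hdet hB hev]
  simp only [add_mul _ _ (ENNReal.toReal _)]
  exact (M.hasSum_second_factorial_moment hS₂).summable.add (M.hasSum_first_moment hS₁).summable

theorem secondMoment_update_iidLaw
    (hS₁ : ∀ V, Summable fun n => M.upsilon s 1 V n * (ρ n).toReal)
    (hS₂ : ∀ V, Summable fun n => M.upsilon s 2 V n * (ρ n).toReal) :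
    secondMoment (M.update (iidLaw ρ s) W) B B = mean (M.update (iidLaw ρ s) W) B +
      (M.missMass s B ^ 2 * M.corrector s ρ W 2 W +
        2 * M.missMass s B * ∑ z ∈ W, M.detMass s z B / M.c z * M.corrector s ρ W 2 (W \ {z}) +
        ∑ z ∈ W, ∑ z' ∈ W, (M.detMass s z B / M.c z) * (M.detMass s z' B / M.c z') *
          if z ≠ z' then M.corrector s ρ W 2 (W \ {z, z'}) else 0) := by
  have hC : (∏ z ∈ W, M.c z) ≠ 0 := Finset.prod_ne_zero_iff.2 fun z hz => (hc z hz).ne'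
  have hs₁ := M.hasSum_first_moment (B := B) (W := W) hS₁
  have hs₂ := M.hasSum_second_factorial_moment (B := B) (W := W) hS₂
  have hs := hs₂.add hs₁
  simp only [← add_mul _ _ (ENNReal.toReal _)] at hs
  rw [M.mean_update_iidLaw hc hdet hB hev hS₁, secondMoment, integral_update,
    M.toReal_evidence_iidLaw hc hdet hev,
    integral_iidLaw (g := fun ξ => count B ξ * count B ξ * M.likelihood W ξ)
      (((measurable_count hB).mul (measurable_count hB)).mul (M.measurable_likelihood W))
      (fun ξ => mul_nonneg (mul_self_nonneg _) (M.likelihood_nonneg W ξ))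
      (M.integrable_integral_count_mul_count_mul_likelihood_eq_upsilon hc hdet hB) hs.summable,
    hs.tsum_eq, ← mul_add, mul_div_mul_left _ _ hC, add_comm]
  have hite : ∀ z z', (if z ≠ z' then M.corrector s ρ W 2 (W \ {z, z'}) else 0) =
      (if z ≠ z' then M.pairing s ρ 2 (W \ {z, z'}) else 0) / M.pairing s ρ 0 W := by
    intro z z'
    split_ifs
    · rfl
    · rw [zero_div]
  simp only [hite]
  simp only [corrector, add_div, Finset.sum_div, Finset.mul_sum, mul_div_assoc]

omit hB in
-- With almost no target detectable, the measurements carry no information on the targets, so a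
-- finite second moment after the update is one of `ρ`.
theorem summable_descFactorial_two_of_memLp
    (hm : MemLp (count Set.univ) 2 (M.update (iidLaw ρ s) W)) (h1 : M.missMass s Set.univ = 1) :
    Summable fun n : ℕ => (n.descFactorial 2 : ℝ) * (ρ n).toReal := by
  have hC : (∏ z ∈ W, M.c z) ≠ 0 := Finset.prod_ne_zero_iff.2 fun z hz => (hc z hz).ne'
  -- All measurements must then be clutter; if that had probability density zero, so would the
  -- evidence.
  have hK : (W.card ! : ℝ) * (M.ρc W.card).toReal ≠ 0 := by
    intro hK
    apply hev
    rw [M.evidence_iidLaw hc hdet, pairing]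
    simp [M.upsilon_of_missMass_eq_one s h1, hK]
  rw [M.memLp_count_update_iff hc hdet MeasurableSet.univ hev] at hm
  simp only [h1, M.detMass_univ_eq_zero s h1, M.upsilon_of_missMass_eq_one s h1, zero_div,
    zero_mul, Finset.sum_const_zero, mul_zero, add_zero, one_pow, one_mul] at hm
  have h := (summable_mul_left_iff (mul_ne_zero hC hK)).1 (hm.congr fun n =>
    show _ = (∏ z ∈ W, M.c z) * ((W.card ! : ℝ) * (M.ρc W.card).toReal) *
      ((n.descFactorial 2 + n.descFactorial 1) * (ρ n).toReal) by ring)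
  refine Summable.of_nonneg_of_le (fun n => by positivity) (fun n => ?_) h
  gcongr
  exact le_add_of_nonneg_right (by positivity)

end Update

end Sensor

theorem summable_sq_of_memLp_iidLaw {X : Type*} [MeasurableSpace X] {s : Measure X}
    [IsProbabilityMeasure s] {ρ : PMF ℕ}
    (h : MemLp (count Set.univ) 2 (iidLaw ρ s)) :
    Summable fun n : ℕ => (n : ℝ) ^ 2 * (ρ n).toReal := by
  rw [memLp_two_iff_integrable_sq (measurable_count MeasurableSet.univ).aestronglyMeasurable,
    integrable_iidLaw_iff ((measurable_count MeasurableSet.univ).pow_const 2)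
      (fun ξ => sq_nonneg _) (j := fun n => (n : ℝ) ^ 2)] at h
  · exact h
  · intro n
    simp [count_ofTuple]

/-! ### Choice of the common law of the points. -/

section IIDProcess

variable {X Z : Type*} [MeasurableSpace X]

theorem IsIIDProcess.exists_iidLaw {P : Measure (Config X)} {ρ : PMF ℕ} {μ : Measure X}
    [IsFiniteMeasure μ] (hP : IsIIDProcess P ρ) (hμ : IsFirstMomentMeasure P μ) :
    ∃ (s : Measure X) (r : ℝ≥0∞), IsProbabilityMeasure s ∧ P = iidLaw ρ s ∧ μ = r • s ∧
      (r.toReal = 0 → ∀ n, n ≠ 0 → ρ n = 0) ∧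
      (Summable fun n : ℕ => (n.descFactorial 1 : ℝ) * (ρ n).toReal) ∧
      ∀ f : X → ℝ, Measurable f → Integrable f μ → Integrable f s := by
  obtain ⟨s, hs, rfl⟩ := hP
  have hμs := eq_smul_of_isFirstMomentMeasure_iidLaw ρ s hμ
  have hr : (∑' n : ℕ, (n : ℝ≥0∞) * ρ n) ≠ ∞ := by
    have h := measure_ne_top μ Set.univ
    rwa [hμs, Measure.smul_apply, measure_univ, smul_eq_mul, mul_one] at h
  have hsum : Summable fun n : ℕ => (n.descFactorial 1 : ℝ) * (ρ n).toReal :=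
    (ENNReal.summable_toReal hr).congr fun n => by simp
  have hzero : (∑' n : ℕ, (n : ℝ≥0∞) * ρ n).toReal = 0 → ∀ n, n ≠ 0 → ρ n = 0 := by
    intro h n hn
    rw [ENNReal.toReal_eq_zero_iff, or_iff_left hr, ENNReal.tsum_eq_zero] at h
    exact (mul_eq_zero.1 (h n)).resolve_left (Nat.cast_ne_zero.2 hn)
  rcases eq_or_ne (∑' n : ℕ, (n : ℝ≥0∞) * ρ n) 0 with h0 | h0
  · obtain ⟨x⟩ : Nonempty X := nonempty_of_isProbabilityMeasure s
    -- Here `μ = 0`, so integrability against `μ` says nothing about `s`. As there are almost surely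
    -- no points, `s` may be replaced by a Dirac mass, for which integrability is automatic.
    refine ⟨Measure.dirac x, 0, inferInstance, ?_, ?_, fun _ => hzero (by simp [h0]), hsum, ?_⟩
    · exact iidLaw_congr_of_eq_zero ρ s (hzero (by simp [h0]))
    · rw [hμs, h0, zero_smul, zero_smul]
    · intro f hf _
      exact integrable_dirac' hf.stronglyMeasurable (by simp)
  · refine ⟨s, _, hs, rfl, hμs, hzero, hsum, fun f _ hf => ?_⟩
    rwa [hμs, integrable_smul_measure h0 hr] at hf

end IIDProcess

end CPHD

/-! ### The regional statistics. -/

theorem theorem1 {X Z : Type*} [MeasurableSpace X] [DecidableEq Z]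
    (M : CPHD.Sensor X Z)
    (P : Measure (CPHD.Config X)) (ρ : PMF ℕ) (μ : Measure X) [IsFiniteMeasure μ]
    (hP : CPHD.IsIIDProcess P ρ) (hμ : CPHD.IsFirstMomentMeasure P μ)
    (W : Finset Z)
    (hc : ∀ z ∈ W, 0 < M.c z)
    (hdet : ∀ z ∈ W, Integrable (M.detKernel z) μ)
    (hev : M.evidence P W ≠ 0) :
    -- the updated process is well defined
    IsProbabilityMeasure (M.update P W) ∧
    -- the mean, all the series in its formula being convergent
    (∀ V ⊆ W, Summable (fun n : ℕ => M.upsilon μ 0 V n * (ρ n).toReal) ∧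
      Summable (fun n : ℕ => M.upsilon μ 1 V n * (ρ n).toReal)) ∧
    (∀ B : Set X, MeasurableSet B →
      Integrable (CPHD.count B) (M.update P W) ∧
      CPHD.mean (M.update P W) B =
        M.missMass μ B * M.ell1Miss μ ρ W +
          ∑ z ∈ W, M.detMass μ z B / M.c z * M.ell1 μ ρ W z) ∧
    -- the variance, as soon as the updated process has a finite second moment
    (MemLp (CPHD.count Set.univ) 2 (M.update P W) →
      (∀ V ⊆ W, Summable (fun n : ℕ => M.upsilon μ 2 V n * (ρ n).toReal)) ∧
      ∀ B : Set X, MeasurableSet B →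
        MemLp (CPHD.count B) 2 (M.update P W) ∧
        CPHD.var (M.update P W) B =
          CPHD.mean (M.update P W) B +
          M.missMass μ B ^ 2 * (M.ell2Miss μ ρ W - M.ell1Miss μ ρ W ^ 2) +
          2 * M.missMass μ B *
            ∑ z ∈ W, M.detMass μ z B / M.c z *
              (M.ell2 μ ρ W z - M.ell1 μ ρ W z * M.ell1Miss μ ρ W) +
          ∑ z ∈ W, ∑ z' ∈ W, (M.detMass μ z B / M.c z) * (M.detMass μ z' B / M.c z') *
            (M.ell2Pair μ ρ W z z' - M.ell1 μ ρ W z * M.ell1 μ ρ W z')) ∧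
    -- which holds whenever the predicted process has a finite second moment
    (MemLp (CPHD.count Set.univ) 2 P → MemLp (CPHD.count Set.univ) 2 (M.update P W)) := by
  obtain ⟨s, r, hs, rfl, rfl, hr, hsum, hint⟩ := hP.exists_iidLaw hμ
  have hdet' : ∀ z ∈ W, Integrable (M.detKernel z) s := fun z hz =>
    hint _ (M.measurable_detKernel z) (hdet z hz)
  have hS₁ : ∀ V, Summable fun n => M.upsilon s 1 V n * (ρ n).toReal :=
    M.summable_upsilon ρ s fun _ => hsum
  have hmean : ∀ B, MeasurableSet B → CPHD.mean (M.update (CPHD.iidLaw ρ s) W) B =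
      M.missMass (r • s) B * M.ell1Miss (r • s) ρ W +
        ∑ z ∈ W, M.detMass (r • s) z B / M.c z * M.ell1 (r • s) ρ W z := by
    intro B hB
    rw [M.mean_update_iidLaw hc hdet' hB hev hS₁]
    -- The factor `r` of each regional mass matches the `r ^ 1` by which the order-one correctors of
    -- `s` and `r • s` differ.
    simp only [CPHD.Sensor.ell1Miss, CPHD.Sensor.ell1, ← M.pow_mul_corrector_smul s hr,
      M.missMass_smul, M.detMass_smul]
    congr 1
    · ring
    · exact Finset.sum_congr rfl fun z _ => by ring
  refine ⟨M.isProbabilityMeasure_update hev (M.evidence_iidLaw_ne_top hc hdet'),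
    fun V _ => ⟨M.summable_upsilon_smul s hr (M.summable_upsilon_zero ρ s V),
      M.summable_upsilon_smul s hr (hS₁ V)⟩,
    fun B hB => ⟨M.integrable_count_update hc hdet' hB hev hS₁, hmean B hB⟩, fun hm => ?_,
    fun hm => ?_⟩
  · have hS₂ : ∀ V, Summable fun n => M.upsilon s 2 V n * (ρ n).toReal :=
      M.summable_upsilon ρ s (M.summable_descFactorial_two_of_memLp hc hdet' hev hm)
    refine ⟨fun V _ => M.summable_upsilon_smul s hr (hS₂ V), fun B hB =>
      ⟨M.memLp_count_update hc hdet' hB hev hS₁ hS₂, ?_⟩⟩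
    have hsecond : CPHD.secondMoment (M.update (CPHD.iidLaw ρ s) W) B B =
        CPHD.mean (M.update (CPHD.iidLaw ρ s) W) B +
        (M.missMass (r • s) B ^ 2 * M.ell2Miss (r • s) ρ W +
          2 * M.missMass (r • s) B *
            ∑ z ∈ W, M.detMass (r • s) z B / M.c z * M.ell2 (r • s) ρ W z +
          ∑ z ∈ W, ∑ z' ∈ W, (M.detMass (r • s) z B / M.c z) *
            (M.detMass (r • s) z' B / M.c z') * M.ell2Pair (r • s) ρ W z z') := by
      have hite : ∀ z z', (if z ≠ z' then M.corrector s ρ W 2 (W \ {z, z'}) else 0) =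
          r.toReal ^ 2 * M.ell2Pair (r • s) ρ W z z' := by
        intro z z'
        rw [CPHD.Sensor.ell2Pair, mul_ite, mul_zero, M.pow_mul_corrector_smul s hr]
      rw [M.secondMoment_update_iidLaw hc hdet' hB hev hS₁ hS₂]
      simp only [hite]
      simp only [CPHD.Sensor.ell2Miss, CPHD.Sensor.ell2, ← M.pow_mul_corrector_smul s hr,
        M.missMass_smul, M.detMass_smul, Finset.mul_sum]
      congr 2
      · congr 1
        · ring
        · exact Finset.sum_congr rfl fun z _ => by ring
      · exact Finset.sum_congr rfl fun z _ => Finset.sum_congr rfl fun z' _ => by ring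
    have hsq : (∑ z ∈ W, M.detMass (r • s) z B / M.c z * M.ell1 (r • s) ρ W z) ^ 2 =
        ∑ z ∈ W, ∑ z' ∈ W, (M.detMass (r • s) z B / M.c z) *
          (M.detMass (r • s) z' B / M.c z') *
            (M.ell1 (r • s) ρ W z * M.ell1 (r • s) ρ W z') := by
      rw [pow_two, Finset.sum_mul_sum]
      exact Finset.sum_congr rfl fun z _ => Finset.sum_congr rfl fun z' _ => by ring
    have hcross : ∑ z ∈ W, M.detMass (r • s) z B / M.c z *
          (M.ell1 (r • s) ρ W z * M.ell1Miss (r • s) ρ W) =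
        (∑ z ∈ W, M.detMass (r • s) z B / M.c z * M.ell1 (r • s) ρ W z) *
          M.ell1Miss (r • s) ρ W := by
      rw [Finset.sum_mul]
      exact Finset.sum_congr rfl fun z _ => by ring
    have hm2 : CPHD.mean (M.update (CPHD.iidLaw ρ s) W) B ^ 2 =
        (M.missMass (r • s) B * M.ell1Miss (r • s) ρ W +
        ∑ z ∈ W, M.detMass (r • s) z B / M.c z * M.ell1 (r • s) ρ W z) ^ 2 := by
      rw [hmean B hB]
    -- Expanding the squared mean gives the `ℓ₁` products: the pure missed term, the cross term and
    -- the double sum, whose diagonal is kept.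
    simp only [CPHD.var, hsecond, hm2, mul_sub, Finset.sum_sub_distrib, hcross, ← hsq]
    ring
  · have hS₂ : ∀ V, Summable fun n => M.upsilon s 2 V n * (ρ n).toReal := by
      refine M.summable_upsilon ρ s fun _ => ?_
      refine Summable.of_nonneg_of_le (fun n => by positivity) (fun n => ?_)
        (CPHD.summable_sq_of_memLp_iidLaw hm)
      gcongr
      exact_mod_cast Nat.descFactorial_le_pow n 2
    exact M.memLp_count_update hc hdet' MeasurableSet.univ hev hS₁ hS₂
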